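/- **Conventions.** A *signature* $\sigma=(S,M,V)$ has sorts $S$, function symbols $f\colon a_1\cdots a_n\to b$ in $M$ (constants when $n=0$) and typed variables $V$, countably infinitely many of each sort; $\tau(t)\in V^*$ is the word of variables of a term $t$ in order of occurrence. A *context* is a word of $V^*$ without repetitions. A *context structure* $R$ is a relation $cRv$ between contexts $c$ and words $v$ such that (i) $cRc$; (ii) $cRv$ implies that every letter of $v$ occurs in $c$; (iii) $cRv^1\cdots v^n$ and $v^iRw^i$ for all $i$ imply $cRw^1\cdots w^n$; (iv) $cRv$ and $dR\,s(c)$ imply $dR\,s(v)$ for every substitution $s$ of words for letters. It is *modelable* if $cRv^1\cdots v^n$ implies that there are contexts $c^i$ with $c^iRv^i$ and $cRc^1\cdots c^n$. An *$R$-equation* $t_1\approx_v t_2$ consists of terms of the same sort with $vR\tau(t_1)$ and $vR\tau(t_2)$; an *$R$-theory* $E$ is a set of $R$-equations. $E\vdash_R$ denotes the closure of $E$ under reflexivity, symmetry, transitivity and the rule: from $t_1\approx_v t_2$ with $v=v_1\cdots v_n$, and $s_1(v_i)\approx_{w_i}s_2(v_i)$ for all $i\le n$, and $wRw_1\cdots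 w_n$, infer $s_1(t_1)\approx_w s_2(t_2)$. $\Delta_R$ is the category of those functions $\theta\colon[m]\to[n]$ with $c_1\cdots c_n\,R\,c_{\theta(1)}\cdots c_{\theta(m)}$ for contexts $c_1\cdots c_n$. A *$\Delta_R$-multicategory* is a multicategory with maps $\theta_*\colon C(a_{\theta(1)}\cdots a_{\theta(m)},b)\to C(a_1\cdots a_n,b)$ for $\theta\in\Delta_R$, functorial in $\theta$ and compatible with composition: $g\circ(\theta^1_*f_1,\dots,\theta^n_*f_n)=(\theta^1+\dots+\theta^n)_*(g\circ(f_1,\dots,f_n))$, and $\theta_*(g)\circ(f_1,\dots,f_n)=\theta'_*(g\circ(f_{\theta(1)},\dots,f_{\theta(m)}))$, where $\theta'$ is the function sending the $i$-th block of inputs identically onto the $\theta(i)$-th block. A *$\sigma$-model* $m$ in it assigns objects to sorts and multimorphisms to function symbols. A term $t\colon b$ with $v=v_1\cdots v_n$, $vR\tau(t)$, is interpreted as $m_v(t)\colon m(v_1)\cdots m(v_n)\to m(b)$, where $m(v_i)$ is the object of the sort of $v_i$, by $m_v(v_i)=\theta_*(\mathrm{id})$ and $m_v(f(t_1,\dots,t_k))=\theta_*\bigl(m(f)\circ(m_{w_1}(t_1),\dots,m_{w_k}(t_k))\bigr)$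 for contexts $w_i$ with $w_iR\tau(t_i)$ and $vRw_1\cdots w_k$; here $\theta$ is in each case the function expressing the inner context as a reindexing of $v$. One writes $m\vDash t_1\approx_v t_2$ if $m_v(t_1)=m_v(t_2)$; an *$E$-model* satisfies all equations of $E$. The *extended signature* $\Sigma$ has sorts $S^*\times S$ and, as function symbols, composition symbols $\circ\colon(b_1\cdots b_n,c)(a^1,b_1)\cdots(a^n,b_n)\to(a^1\cdots a^n,c)$, identities $\mathrm{id}_c\colon(c,c)$, action symbols $\theta_*\colon(b_{\theta(1)}\cdots b_{\theta(m)},c)\to(b_1\cdots b_n,c)$ for $\theta\in\Delta_R$, and a constant $f\colon(a,b)$ for each $f\colon a\to b$ in $M$. The *categorization* $\overline\sigma$ of $\sigma$ is the equational $\Sigma$-theory consisting of the axioms of $\Delta_R$-multicategories. For a term $t$ with $R$-context $v$, let $N_v(t)$ be the variable-free $\Sigma$-term obtained by copying the recursion for $m_v(t)$ with the symbols of $\Sigma$, using any fixed choice of the contexts $w_1,\dots,w_k$ of the immediate subterms (for example terminal contexts, where they exist; a context $c$ is terminal for a word $u$ if $wRc\Leftrightarrow wRu$ for all contexts $w$).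 Put $\overline E=\overline\sigma\cup\{N_v(t_1)\approx_{()}N_v(t_2)\mid t_1\approx_v t_2\in E\}$. A model of $\overline E$ in sets is a $\Delta_R$-multicategory with set of objects $S$ together with a $\sigma$-model in it. **Theorem (Completeness of the universal model).** Let $\sigma$ be a signature with a modelable context structure $R$ and let $E$ be an $R$-theory. An initial $\overline E$-model in sets exists. Let $C$ be an initial $\overline E$-model, regarded as a $\Delta_R$-multicategory, and let $m$ be the $\sigma$-model it carries. Then $m$ is an $E$-model and: 1. $(C,m)$ is initial among $\Delta_R$-multicategories equipped with an $E$-model: for every $\Delta_R$-multicategory $D$ and every $E$-model $n$ in $D$ there is exactly one morphism $T\colon C\to D$ of $\Delta_R$-multicategories with $T(m)=n$. 2. For every $R$-equation $\varphi$: $E\vdash_R\varphi$ if and only if $m\vDash\varphi$. Consequently $E\vdash_R\varphi$ if and only if every $E$-model in every $\Delta_R$-multicategory satisfies $\varphi$. -/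

import Mathlib

universe u v w w' uS uM uV

/-! ### Words -/

/-- A finite word over an alphabet `α`: a length `n` together with letters indexed by `Fin n`. -/
@[ext]
structure Word (α : Type u) : Type u where
  len : ℕ
  get : Fin len → α

namespace Word

variable {α : Type u} {β : Type v}

/-- Apply a function letter by letter. -/
def map (f : α → β) (a : Word α) : Word β := ⟨a.len, fun i => f (a.get i)⟩

/-- The word `a₁ a₂ ⋯ aₙ` obtained by concatenating the words `a 0, …, a (n-1)`.  A position of the
concatenation is a pair (number of the block, position in the block), enumerated
lexicographically by `finSigmaFinEquiv`. -/
def concat {n : ℕ} (a : Fin n → Word α) : Word α :=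
  ⟨∑ i, (a i).len, fun k => (a (finSigmaFinEquiv.symm k).1).get (finSigmaFinEquiv.symm k).2⟩

/-- The one-letter word. -/
def single (x : α) : Word α := ⟨1, fun _ => x⟩

/-- The empty word. -/
def nil : Word α := ⟨0, fun i => i.elim0⟩

end Word

/-! ### Coproducts and similarities of functions between finite ordinals -/

/-- The coproduct `f₁ + ⋯ + fₙ` of functions between finite ordinals. -/
def finCoprod {n : ℕ} {k l : Fin n → ℕ} (f : ∀ i, Fin (k i) → Fin (l i)) :
    Fin (∑ i, k i) → Fin (∑ i, l i) := fun x =>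
  finSigmaFinEquiv ⟨(finSigmaFinEquiv.symm x).1,
    f (finSigmaFinEquiv.symm x).1 (finSigmaFinEquiv.symm x).2⟩

/-- The component at `k₁, …, kₙ` of the similarity of `θ : [m] → [n]`: it sends the `x`-th element
of the `i`-th block (of size `k (θ i)`) to the `x`-th element of the `θ i`-th block. -/
def finSimilarity {m n : ℕ} (θ : Fin m → Fin n) (k : Fin n → ℕ) :
    Fin (∑ i, k (θ i)) → Fin (∑ j, k j) := fun x =>
  finSigmaFinEquiv ⟨θ (finSigmaFinEquiv.symm x).1, (finSigmaFinEquiv.symm x).2⟩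

/-! ### Word calculus needed to state the axioms -/

lemma finSigma_lt {n : ℕ} {k : Fin n → ℕ} {i i' : Fin n} (h : i < i') (x : Fin (k i))
    (x' : Fin (k i')) :
    (finSigmaFinEquiv (⟨i, x⟩ : (i : Fin n) × Fin (k i))) < finSigmaFinEquiv ⟨i', x'⟩ := by
  rw [Fin.lt_def, finSigmaFinEquiv_apply, finSigmaFinEquiv_apply]
  have h1 : (∑ j : Fin (i.1 + 1), k (Fin.castLE i.2 j)) ≤
      ∑ j : Fin i'.1, k (Fin.castLE i'.2.le j) := by
    have h2 : ∀ a : ℕ, ∀ ha : a ≤ n, (∑ j : Fin a, k (Fin.castLE ha j)) =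
        ∑ j ∈ Finset.univ.filter (fun j : Fin n => j.1 < a), k j := by
      intro a ha
      refine Finset.sum_bij (fun j _ => Fin.castLE ha j) ?_ ?_ ?_ ?_
      · intro j _; simp
      · intro j _ j' _ h; simpa [Fin.ext_iff] using h
      · intro j hj
        exact ⟨⟨j.1, by simpa using hj⟩, by simp, by simp⟩
      · intro j _; rfl
    rw [h2 _ i.2, h2 _ i'.2.le]
    refine Finset.sum_le_sum_of_subset ?_
    intro j hj
    simp only [Finset.mem_filter, Finset.mem_univ, true_and] at hj ⊢
    have : i.1 < i'.1 := h
    omega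
  rw [Fin.sum_univ_castSucc] at h1
  have h3 : k (Fin.castLE i.2 (Fin.last i.1)) = k i := by congr 1
  rw [h3] at h1
  have h4 : (∑ j : Fin i.1, k (Fin.castLE i.2 j.castSucc)) =
    ∑ j : Fin i.1, k (Fin.castLE i.2.le j) := rfl
  have := x.2
  dsimp only
  omega

lemma finSigma_lt' {n : ℕ} {k : Fin n → ℕ} {i : Fin n} {x x' : Fin (k i)} (h : x < x') :
    (finSigmaFinEquiv (⟨i, x⟩ : (i : Fin n) × Fin (k i))) < finSigmaFinEquiv ⟨i, x'⟩ := by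
  rw [Fin.lt_def, finSigmaFinEquiv_apply, finSigmaFinEquiv_apply]
  exact Nat.add_lt_add_left h _

lemma finSigma_lt_cases {n : ℕ} {k : Fin n → ℕ} {p q : (i : Fin n) × Fin (k i)}
    (h : finSigmaFinEquiv p < finSigmaFinEquiv q) :
    p.1 < q.1 ∨ ∃ (i : Fin n) (x x' : Fin (k i)), x < x' ∧ p = ⟨i, x⟩ ∧ q = ⟨i, x'⟩ := by
  obtain ⟨i, x⟩ := p
  obtain ⟨j, y⟩ := q
  rcases lt_trichotomy i j with hij | hij | hij
  · exact Or.inl hij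
  · subst hij
    rcases lt_trichotomy x y with hxy | hxy | hxy
    · exact Or.inr ⟨i, x, y, hxy, rfl, rfl⟩
    · subst hxy; exact absurd h (lt_irrefl _)
    · exact absurd h (lt_asymm (finSigma_lt' hxy))
  · exact absurd h (lt_asymm (finSigma_lt hij _ _))

lemma finSigma_symm_cases {n : ℕ} {k : Fin n → ℕ} {x y : Fin (∑ i, k i)} (h : x < y) :
    (finSigmaFinEquiv.symm x).1 < (finSigmaFinEquiv.symm y).1 ∨
      ∃ (i : Fin n) (z z' : Fin (k i)), z < z' ∧ finSigmaFinEquiv.symm x = ⟨i, z⟩ ∧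
        finSigmaFinEquiv.symm y = ⟨i, z'⟩ :=
  finSigma_lt_cases (by simpa only [Equiv.apply_symm_apply] using h)

namespace Word

variable {α : Type u} {β : Type v}

lemma ext_of_strictMono {a b : Word α} (hl : a.len = b.len) (f : Fin a.len → Fin b.len)
    (hf : StrictMono f) (h : ∀ i, a.get i = b.get (f i)) : a = b := by
  obtain ⟨n, a⟩ := a
  obtain ⟨n', b⟩ := b
  dsimp only at hl f hf h
  subst hl
  have : f = id := by
    have hs : Function.Surjective f := Finite.surjective_of_injective hf.injective
    exact (StrictMono.range_inj hf strictMono_id).1 (by rw [hs.range_eq]; simp)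
  subst this
  congr 1
  funext i
  exact h i

lemma concat_get {n : ℕ} (a : Fin n → Word α) (p : (i : Fin n) × Fin (a i).len) :
    (concat a).get (finSigmaFinEquiv p) = (a p.1).get p.2 := by
  have : ∀ q, q = p → (a q.1).get q.2 = (a p.1).get p.2 := by rintro _ rfl; rfl
  exact this _ (Equiv.symm_apply_apply _ _)

lemma concat_concat {n : ℕ} {m : Fin n → ℕ} (a : ∀ i, Fin (m i) → Word α) :
    concat (fun k : Fin (∑ i, m i) =>
      a (finSigmaFinEquiv.symm k).1 (finSigmaFinEquiv.symm k).2) =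
    concat (fun i => concat (a i)) := by
  have hl : (concat (fun k : Fin (∑ i, m i) =>
      a (finSigmaFinEquiv.symm k).1 (finSigmaFinEquiv.symm k).2)).len =
      (concat (fun i => concat (a i))).len := by
    change (∑ k : Fin (∑ i, m i),
      (a (finSigmaFinEquiv.symm k).1 (finSigmaFinEquiv.symm k).2).len) = ∑ i, ∑ j, (a i j).len
    rw [Equiv.sum_comp finSigmaFinEquiv.symm
      (fun p : (i : Fin n) × Fin (m i) => (a p.1 p.2).len), Fintype.sum_sigma]
  refine ext_of_strictMono hl
    (fun x => finSigmaFinEquiv (n := fun i => (concat (a i)).len)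
      ⟨(finSigmaFinEquiv.symm (finSigmaFinEquiv.symm x).1).1,
      finSigmaFinEquiv (n := fun j => (a _ j).len)
        ⟨(finSigmaFinEquiv.symm (finSigmaFinEquiv.symm x).1).2,
        (finSigmaFinEquiv.symm x).2⟩⟩) ?_ ?_
  · intro x y hxy
    dsimp only
    rcases finSigma_symm_cases hxy with h | ⟨i, z, z', hz, hp, hq⟩
    · generalize finSigmaFinEquiv.symm x = p at h
      generalize finSigmaFinEquiv.symm y = q at h
      obtain ⟨p1, p2⟩ := p
      obtain ⟨q1, q2⟩ := q
      dsimp only at h p2 q2 ⊢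
      have key : ∀ (r s : (i : Fin n) × Fin (m i)) (p2 : Fin (a r.1 r.2).len)
          (q2 : Fin (a s.1 s.2).len),
          (r.1 < s.1 ∨ ∃ (i : Fin n) (z z' : Fin (m i)), z < z' ∧ r = ⟨i, z⟩ ∧ s = ⟨i, z'⟩) →
          finSigmaFinEquiv (n := fun i => (concat (a i)).len)
            ⟨r.1, finSigmaFinEquiv (n := fun j => (a r.1 j).len) ⟨r.2, p2⟩⟩ <
          finSigmaFinEquiv (n := fun i => (concat (a i)).len)
            ⟨s.1, finSigmaFinEquiv (n := fun j => (a s.1 j).len) ⟨s.2, q2⟩⟩ := by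
        rintro r s p2 q2 (h' | ⟨i, z, z', hz, rfl, rfl⟩)
        · exact finSigma_lt h' _ _
        · exact finSigma_lt' (finSigma_lt hz _ _)
      exact key _ _ _ _ (finSigma_symm_cases h)
    · rw [hp, hq]
      exact finSigma_lt' (k := fun i => (concat (a i)).len)
        (finSigma_lt' (k := fun j => (a _ j).len) hz)
  · intro x
    dsimp only
    rw [concat_get (fun i => concat (a i)), concat_get (fun j => a _ j)]
    rfl

lemma concat_single {n : ℕ} (a : Fin n → α) : concat (fun i => single (a i)) = ⟨n, a⟩ := by
  refine ext_of_strictMono (by simp [concat, single]) (fun x => (finSigmaFinEquiv.symm x).1) ?_ ?_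
  · intro x y hxy
    rcases finSigma_symm_cases hxy with h | ⟨i, z, z', hz, hp, hq⟩
    · exact h
    · exact absurd hz (by
        have h1 : z.1 < 1 := z.2
        have h2 : z'.1 < 1 := z'.2
        rw [Fin.lt_def]; omega)
  · intro x; rfl

lemma concat_one (a : Word α) : concat (fun _ : Fin 1 => a) = a := by
  refine ext_of_strictMono (by simp [concat]) (fun x => (finSigmaFinEquiv.symm x).2) ?_ ?_
  · intro x y hxy
    dsimp only
    rcases finSigma_symm_cases hxy with h | ⟨i, z, z', hz, hp, hq⟩
    · exact absurd h (by simp [Subsingleton.elim (finSigmaFinEquiv.symm x).1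
        (finSigmaFinEquiv.symm y).1])
    · rw [hp, hq]; exact hz
  · intro x; rfl

lemma range_concat {n : ℕ} (a : Fin n → Word α) :
    Set.range (concat a).get = ⋃ i, Set.range (a i).get := by
  ext x
  simp only [Set.mem_range, Set.mem_iUnion]
  constructor
  · rintro ⟨k, rfl⟩
    exact ⟨_, _, rfl⟩
  · rintro ⟨i, j, rfl⟩
    exact ⟨finSigmaFinEquiv ⟨i, j⟩, concat_get a ⟨i, j⟩⟩

/-- Naturality of concatenation with respect to coproducts of functions. -/
lemma concat_coprod {n : ℕ} {k : Fin n → ℕ} (a : Fin n → Word α)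
    (σ : ∀ i, Fin (k i) → Fin (a i).len) :
    concat (fun i => (⟨k i, fun j => (a i).get (σ i j)⟩ : Word α)) =
      ⟨∑ i, k i, fun x => (concat a).get (finCoprod σ x)⟩ := by
  unfold finCoprod
  simp only [concat_get]
  rfl

/-- Naturality of concatenation with respect to similarities. -/
lemma concat_similarity {m n : ℕ} (θ : Fin m → Fin n) (a : Fin n → Word α) :
    concat (fun i => a (θ i)) =
      ⟨∑ i, (a (θ i)).len,
        fun x => (concat a).get (finSimilarity θ (fun j => (a j).len) x)⟩ := by
  unfold finSimilarity
  simp only [concat_get]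
  rfl

end Word

/-! ### Structure categories -/

/-- A structure category: a wide subcategory of the category of finite ordinals and functions,
closed under coproducts of morphisms and under components of similarities. -/
structure StructureCategory where
  mem : ∀ {m n : ℕ}, (Fin m → Fin n) → Prop
  id_mem : ∀ n : ℕ, mem (id : Fin n → Fin n)
  comp_mem : ∀ {k m n : ℕ} {σ : Fin k → Fin m} {τ : Fin m → Fin n},
    mem σ → mem τ → mem (τ ∘ σ)
  coprod_mem : ∀ {n : ℕ} {k l : Fin n → ℕ} {f : ∀ i, Fin (k i) → Fin (l i)},
    (∀ i, mem (f i)) → mem (finCoprod f)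
  similarity_mem : ∀ {m n : ℕ} {θ : Fin m → Fin n} (k : Fin n → ℕ),
    mem θ → mem (finSimilarity θ k)

/-! ### `Δ`-multicategories -/

/-- Transport of a multimorphism (or of a term, or of an element) along an equality of its
domain words. -/
def castDom {α : Type u} {β : Type v} {H : Word α → β → Type w} {a a' : Word α} {b : β}
    (h : a = a') (f : H a b) : H a' b := h ▸ f

/-- A `Δ`-multicategory, for a structure category `Δ`.  The transports `castDom` only identify
words which are equal by the associativity and unit laws of concatenation, or by the definitions
of the coproduct and of the similarity. -/
structure DeltaMulticategory (Δ : StructureCategory) where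
  Obj : Type w
  Hom : Word Obj → Obj → Type w'
  /-- composition `g ∘ (f₁, …, fₙ)` -/
  comp : ∀ {n : ℕ} {b : Fin n → Obj} {a : Fin n → Word Obj} {c : Obj},
    Hom ⟨n, b⟩ c → (∀ i, Hom (a i) (b i)) → Hom (Word.concat a) c
  /-- identities -/
  id : ∀ a : Obj, Hom (Word.single a) a
  /-- the action `θ_* : C(a_{θ(1)} ⋯ a_{θ(m)}, b) → C(a₁ ⋯ aₙ, b)` -/
  act : ∀ {m n : ℕ} (θ : Fin m → Fin n), Δ.mem θ → ∀ (a : Fin n → Obj) (b : Obj),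
    Hom ⟨m, fun i => a (θ i)⟩ b → Hom ⟨n, a⟩ b
  assoc : ∀ {n : ℕ} {m : Fin n → ℕ} {c : Fin n → Obj} {d : Obj} {b : ∀ i, Fin (m i) → Obj}
    {a : ∀ i, Fin (m i) → Word Obj} (h : Hom ⟨n, c⟩ d) (g : ∀ i, Hom ⟨m i, b i⟩ (c i))
    (f : ∀ i j, Hom (a i j) (b i j)),
    castDom (Word.concat_concat a)
      (comp (n := ∑ i, m i) (comp h g)
        (fun k => f (finSigmaFinEquiv.symm k).1 (finSigmaFinEquiv.symm k).2)) =
      comp h (fun i => comp (g i) (f i))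
  comp_id : ∀ {n : ℕ} {a : Fin n → Obj} {b : Obj} (f : Hom ⟨n, a⟩ b),
    castDom (Word.concat_single a) (comp f (fun i => id (a i))) = f
  id_comp : ∀ {a : Word Obj} {b : Obj} (f : Hom a b),
    castDom (Word.concat_one a) (comp (id b) (fun _ => f)) = f
  act_id : ∀ {n : ℕ} {a : Fin n → Obj} {b : Obj} (f : Hom ⟨n, a⟩ b),
    act _root_.id (Δ.id_mem n) a b f = f
  act_comp : ∀ {k m n : ℕ} {σ : Fin k → Fin m} {τ : Fin m → Fin n} (hσ : Δ.mem σ)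
    (hτ : Δ.mem τ) {a : Fin n → Obj} {b : Obj} (f : Hom ⟨k, fun i => a (τ (σ i))⟩ b),
    act (τ ∘ σ) (Δ.comp_mem hσ hτ) a b f = act τ hτ a b (act σ hσ (fun i => a (τ i)) b f)
  comp_act : ∀ {n : ℕ} {k : Fin n → ℕ} {b : Fin n → Obj} {c : Obj} {a : Fin n → Word Obj}
    {σ : ∀ i, Fin (k i) → Fin (a i).len} (hσ : ∀ i, Δ.mem (σ i)) (g : Hom ⟨n, b⟩ c)
    (f : ∀ i, Hom ⟨k i, fun j => (a i).get (σ i j)⟩ (b i)),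
    comp g (fun i => act (σ i) (hσ i) (a i).get (b i) (f i)) =
      act (finCoprod σ) (Δ.coprod_mem hσ) (Word.concat a).get c
        (castDom (Word.concat_coprod a σ) (comp g f))
  act_comp' : ∀ {m n : ℕ} {τ : Fin m → Fin n} (hτ : Δ.mem τ) {b : Fin n → Obj} {c : Obj}
    {a : Fin n → Word Obj} (g : Hom ⟨m, fun i => b (τ i)⟩ c) (f : ∀ i, Hom (a i) (b i)),
    comp (act τ hτ b c g) f =
      act (finSimilarity τ (fun j => (a j).len)) (Δ.similarity_mem _ hτ) (Word.concat a).get c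
        (castDom (Word.concat_similarity τ a) (comp g (fun i => f (τ i))))

/-- Morphisms of `Δ`-multicategories. -/
@[ext]
structure DeltaMulticategory.Functor {Δ : StructureCategory} (C : DeltaMulticategory.{u, v} Δ)
    (D : DeltaMulticategory.{w, w'} Δ) where
  obj : C.Obj → D.Obj
  map : ∀ {a : Word C.Obj} {b : C.Obj}, C.Hom a b → D.Hom (a.map obj) (obj b)
  map_comp : ∀ {n : ℕ} {b : Fin n → C.Obj} {a : Fin n → Word C.Obj} {c : C.Obj}
    (g : C.Hom ⟨n, b⟩ c) (f : ∀ i, C.Hom (a i) (b i)),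
    map (C.comp g f) =
      D.comp (b := fun i => obj (b i)) (a := fun i => (a i).map obj) (map g) (fun i => map (f i))
  map_id : ∀ a : C.Obj, map (C.id a) = D.id (obj a)
  map_act : ∀ {m n : ℕ} (θ : Fin m → Fin n) (hθ : Δ.mem θ) (a : Fin n → C.Obj) (b : C.Obj)
    (g : C.Hom ⟨m, fun i => a (θ i)⟩ b),
    map (C.act θ hθ a b g) = D.act θ hθ (fun i => obj (a i)) (obj b) (map g)

/-! ### Context structures -/

/-- A context structure on an alphabet `V`: a relation `rel c v` between contexts `c` (words
without repetitions) and words `v`. -/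
structure ContextStructure (V : Type u) where
  rel : Word V → Word V → Prop
  context : ∀ {c v : Word V}, rel c v → Function.Injective c.get
  refl : ∀ {c : Word V}, Function.Injective c.get → rel c c
  expressed : ∀ {c v : Word V}, rel c v → Set.range v.get ⊆ Set.range c.get
  trans : ∀ {n : ℕ} {c : Word V} {v w : Fin n → Word V}, rel c (Word.concat v) →
    (∀ i, rel (v i) (w i)) → rel c (Word.concat w)
  subst : ∀ {c v d : Word V} (s : V → Word V), rel c v →
    rel d (Word.concat (fun i => s (c.get i))) → rel d (Word.concat (fun i => s (v.get i)))

namespace ContextStructure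

variable {V : Type u}

/-- `R` is modelable if every context of a concatenation can be split. -/
def Modelable (R : ContextStructure V) : Prop :=
  ∀ {n : ℕ} {c : Word V} {v : Fin n → Word V}, R.rel c (Word.concat v) →
    ∃ w : Fin n → Word V, R.rel c (Word.concat w) ∧ ∀ i, R.rel (w i) (v i)

/-- `c` is a terminal `R`-context of the word `v`. -/
def IsTerminalContext (R : ContextStructure V) (c v : Word V) : Prop :=
  Function.Injective c.get ∧
    ∀ w : Word V, Function.Injective w.get → (R.rel w c ↔ R.rel w v)

/-- A choice, for every context `c` of a concatenation `v₁ ⋯ vₙ`, of contexts `wᵢ` of the `vᵢ`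
such that `c` is a context of `w₁ ⋯ wₙ`. -/
structure ContextChoice (R : ContextStructure V) where
  ctx : ∀ {n : ℕ} {c : Word V} {v : Fin n → Word V}, R.rel c (Word.concat v) → Fin n → Word V
  rel_concat : ∀ {n : ℕ} {c : Word V} {v : Fin n → Word V} (h : R.rel c (Word.concat v)),
    R.rel c (Word.concat (ctx h))
  rel_ctx : ∀ {n : ℕ} {c : Word V} {v : Fin n → Word V} (h : R.rel c (Word.concat v)) (i : Fin n),
    R.rel (ctx h i) (v i)

/-- Choosing a terminal context `tc v` for every `R`-word `v` is a particular case. -/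
def ContextChoice.ofTerminal {R : ContextStructure V} (hR : R.Modelable) (tc : Word V → Word V)
    (htc : ∀ c v, R.rel c v → R.IsTerminalContext (tc v) v) : R.ContextChoice where
  ctx := fun {_ _ v} _ i => tc (v i)
  rel_concat := by
    intro n c v h
    obtain ⟨w, hw, hwv⟩ := hR h
    exact R.trans hw fun i =>
      ((htc _ _ (hwv i)).2 _ (R.context (hwv i))).2 (hwv i)
  rel_ctx := by
    intro n c v h i
    obtain ⟨w, hw, hwv⟩ := hR h
    have ht := htc _ _ (hwv i)
    exact (ht.2 _ ht.1).1 (R.refl ht.1)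

/-- Some choice of contexts for a modelable `R`. -/
noncomputable def Modelable.choice {R : ContextStructure V} (hR : R.Modelable) :
    R.ContextChoice where
  ctx h := (hR h).choose
  rel_concat h := (hR h).choose_spec.1
  rel_ctx h i := (hR h).choose_spec.2 i

/-- The function `θ` with `w = v_{θ(1)} ⋯ v_{θ(m)}`, for a context `v` of `w`. -/
noncomputable def fn (R : ContextStructure V) {v w : Word V} (h : R.rel v w) :
    Fin w.len → Fin v.len :=
  fun i => (R.expressed h ⟨i, rfl⟩).choose

lemma get_fn (R : ContextStructure V) {v w : Word V} (h : R.rel v w) (i : Fin w.len) :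
    v.get (R.fn h i) = w.get i :=
  (R.expressed h ⟨i, rfl⟩).choose_spec

lemma eq_fn (R : ContextStructure V) {v w : Word V} (h : R.rel v w) :
    w = ⟨w.len, fun i => v.get (R.fn h i)⟩ := by
  simp only [get_fn]

lemma map_eq_fn {α : Type v} (R : ContextStructure V) {v w : Word V} (h : R.rel v w)
    (f : V → α) : w.map f = ⟨w.len, fun i => (v.map f).get (R.fn h i)⟩ := by
  simp only [Word.map, get_fn]

/-- Membership in `Δ_R`: `c₁ ⋯ cₙ R c_{θ(1)} ⋯ c_{θ(m)}` for contexts `c₁ ⋯ cₙ`. -/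
def deltaMem (R : ContextStructure V) {m n : ℕ} (θ : Fin m → Fin n) : Prop :=
  ∀ c : Fin n → V, Function.Injective c → R.rel ⟨n, c⟩ ⟨m, fun i => c (θ i)⟩

lemma rel_rename (R : ContextStructure V) {m n : ℕ} {θ : Fin m → Fin n} {d : Fin n → V}
    (hd : Function.Injective d) (h : R.rel ⟨n, d⟩ ⟨m, fun i => d (θ i)⟩)
    {e : Word V} (a : Fin n → Word V) (he : R.rel e (Word.concat a)) :
    R.rel e (Word.concat (fun i => a (θ i))) := by
  classical
  let s : V → Word V := fun x =>
    ((Function.invFun (fun o : Option (Fin n) => o.map d) (some x)).map a).getD Word.nil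
  have hs : ∀ j, s (d j) = a j := by
    intro j
    have h1 : Function.Injective (fun o : Option (Fin n) => o.map d) :=
      Option.map_injective hd
    have h2 := Function.leftInverse_invFun h1 (some j)
    simp only [Option.map_some] at h2
    simp only [s, h2, Option.map_some, Option.getD_some]
  have := R.subst (d := e) s h (by simpa only [hs] using he)
  simpa only [hs] using this

lemma fn_mem (R : ContextStructure V) {v w : Word V} (h : R.rel v w) :
    R.deltaMem (R.fn h) := by
  intro c hc
  have h' : R.rel ⟨v.len, v.get⟩ ⟨w.len, fun i => v.get (R.fn h i)⟩ := by
    rw [← R.eq_fn h]; exact h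
  have := R.rel_rename (R.context h) h' (e := ⟨v.len, c⟩) (fun i => Word.single (c i))
    (by rw [Word.concat_single]; exact R.refl hc)
  rwa [Word.concat_single (fun i => c (R.fn h i))] at this

lemma exists_context (hV : IsEmpty V ∨ Infinite V) (n : ℕ) :
    (∃ d : Fin n → V, Function.Injective d) ∨ IsEmpty V := by
  rcases hV with h | h
  · exact Or.inr h
  · exact Or.inl ⟨fun i => Infinite.natEmbedding V i,
      fun i j hij => Fin.ext ((Infinite.natEmbedding V).injective hij)⟩

/-- The structure category `Δ_R` of a context structure `R` on an infinite alphabet.  (The empty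
alphabet is allowed because it occurs for the signature without sorts.) -/
def delta (R : ContextStructure V) (hV : IsEmpty V ∨ Infinite V) : StructureCategory where
  mem := R.deltaMem
  id_mem := fun n c hc => R.refl hc
  comp_mem := by
    intro k m n σ τ hσ hτ c hc
    rcases exists_context hV m with ⟨d, hd⟩ | hE
    · have := R.rel_rename hd (hσ d hd) (e := ⟨n, c⟩) (fun i => Word.single (c (τ i)))
        (by rw [Word.concat_single (fun i => c (τ i))]; exact hτ c hc)
      rwa [Word.concat_single (fun i => c (τ (σ i)))] at this
    · have hn : IsEmpty (Fin n) := ⟨fun i => hE.false (c i)⟩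
      have hm : IsEmpty (Fin m) := ⟨fun i => hn.false (τ i)⟩
      have hσ' := hσ (fun i => (hm.false i).elim) (fun i => (hm.false i).elim)
      have hn' : n = 0 := Nat.eq_zero_of_not_pos fun h => hn.false ⟨0, h⟩
      have hm' : m = 0 := Nat.eq_zero_of_not_pos fun h => hm.false ⟨0, h⟩
      subst hn' hm'
      convert hσ' using 2
  coprod_mem := by
    intro n k l f hf c hc
    let a : Fin n → Word V := fun i => ⟨l i, fun j => c (finSigmaFinEquiv ⟨i, j⟩)⟩
    have ha : Word.concat a = ⟨∑ i, l i, c⟩ := by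
      change (⟨∑ i, l i, fun x => c (finSigmaFinEquiv (finSigmaFinEquiv.symm x))⟩ : Word V) = _
      simp only [Equiv.apply_symm_apply]
    have h1 : R.rel ⟨∑ i, l i, c⟩ (Word.concat a) := by rw [ha]; exact R.refl hc
    exact R.trans h1 (w := fun i => ⟨k i, fun j => (a i).get (f i j)⟩) fun i => hf i _
      fun x y hxy => by simpa using finSigmaFinEquiv.injective (hc hxy)
  similarity_mem := by
    intro m n θ k hθ c hc
    let a : Fin n → Word V := fun i => ⟨k i, fun j => c (finSigmaFinEquiv ⟨i, j⟩)⟩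
    have ha : Word.concat a = ⟨∑ i, k i, c⟩ := by
      change (⟨∑ i, k i, fun x => c (finSigmaFinEquiv (finSigmaFinEquiv.symm x))⟩ : Word V) = _
      simp only [Equiv.apply_symm_apply]
    have h1 : R.rel ⟨∑ i, k i, c⟩ (Word.concat a) := by rw [ha]; exact R.refl hc
    rcases exists_context hV n with ⟨d, hd⟩ | hE
    · exact R.rel_rename hd (hθ d hd) a h1
    · have hn : IsEmpty (Fin (∑ i, k i)) := ⟨fun i => hE.false (c i)⟩
      have hm : IsEmpty (Fin (∑ i, k (θ i))) := ⟨fun i => hn.false (finSimilarity θ k i)⟩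
      have hn' : ∑ i, k i = 0 := Nat.eq_zero_of_not_pos fun h => hn.false ⟨0, h⟩
      have hm' : ∑ i, k (θ i) = 0 := Nat.eq_zero_of_not_pos fun h => hm.false ⟨0, h⟩
      have : (⟨∑ i, k (θ i), fun x => c (finSimilarity θ k x)⟩ : Word V) = ⟨∑ i, k i, c⟩ := by
        refine Word.ext_of_strictMono (hm'.trans hn'.symm) (finSimilarity θ k)
          (fun i => (hm.false i).elim) (fun i => rfl)
      rw [this]
      exact R.refl hc

/-- The cartesian context structure. -/
def cartesian (V : Type u) : ContextStructure V where
  rel c v := Function.Injective c.get ∧ Set.range v.get ⊆ Set.range c.get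
  context h := h.1
  refl h := ⟨h, subset_rfl⟩
  expressed h := h.2
  trans := by
    intro n c v w h h'
    refine ⟨h.1, ?_⟩
    rw [Word.range_concat]
    refine Set.iUnion_subset fun i => (h' i).2.trans (subset_trans ?_ h.2)
    rw [Word.range_concat]
    exact Set.subset_iUnion (fun i => Set.range (v i).get) i
  subst := by
    intro c v d s h h'
    refine ⟨h'.1, subset_trans ?_ h'.2⟩
    rw [Word.range_concat, Word.range_concat]
    refine Set.iUnion_subset fun i => ?_
    obtain ⟨j, hj⟩ := h.2 ⟨i, rfl⟩
    rw [← hj]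
    exact Set.subset_iUnion (fun j => Set.range (s (c.get j)).get) j

end ContextStructure

/-! ### Signatures, terms, theories, deduction -/

/-- A multisorted signature: sorts `S`, function symbols `M` with a typing, and typed variables
`V`, countably infinitely many of each sort. -/
structure Signature where
  S : Type uS
  M : Type uM
  V : Type uV
  dom : M → Word S
  cod : M → S
  vty : V → S
  infinite_fiber : ∀ s, Infinite {x : V // vty x = s}
  countable_fiber : ∀ s, Countable {x : V // vty x = s}

/-- Terms of a given sort.  Constant symbols are the function symbols of arity `0`. -/
inductive Term (σ : Signature.{uS, uM, uV}) : σ.S → Type (max uS uM uV)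
  | var (x : σ.V) : Term σ (σ.vty x)
  | app (f : σ.M) (t : ∀ i : Fin (σ.dom f).len, Term σ ((σ.dom f).get i)) : Term σ (σ.cod f)

namespace Term

variable {σ : Signature.{uS, uM, uV}}

/-- The word `τ(t)` of the variables of `t`, in order of occurrence. -/
def tau : ∀ {s : σ.S}, Term σ s → Word σ.V
  | _, var x => Word.single x
  | _, app _ t => Word.concat (fun i => (t i).tau)

/-- Simultaneous replacement of the variables of a term by terms of the same sort. -/
def subst (r : ∀ x : σ.V, Term σ (σ.vty x)) : ∀ {s : σ.S}, Term σ s → Term σ s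
  | _, var x => r x
  | _, app f t => app f (fun i => (t i).subst r)

end Term

lemma Signature.isEmpty_or_infinite (σ : Signature.{uS, uM, uV}) : IsEmpty σ.V ∨ Infinite σ.V := by
  rcases isEmpty_or_nonempty σ.V with h | ⟨⟨x⟩⟩
  · exact Or.inl h
  · have := σ.infinite_fiber (σ.vty x)
    exact Or.inr (Infinite.of_injective
      (fun y : {y : σ.V // σ.vty y = σ.vty x} => y.1) Subtype.val_injective)

/-- The structure category `Δ_R` of a context structure on the variables of a signature. -/
abbrev Signature.delta (σ : Signature.{uS, uM, uV}) (R : ContextStructure σ.V) :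
    StructureCategory :=
  R.delta σ.isEmpty_or_infinite

/-- An `R`-equation `lhs ≈_ctx rhs`. -/
structure REquation (σ : Signature.{uS, uM, uV}) (R : ContextStructure σ.V) where
  ctx : Word σ.V
  sort : σ.S
  lhs : Term σ sort
  rhs : Term σ sort
  rel_lhs : R.rel ctx lhs.tau
  rel_rhs : R.rel ctx rhs.tau

/-- `R`-deduction from an `R`-theory `E`.  In the last rule `(r₁, w, (wᵢ))` and `(r₂, w, (wᵢ))` are
`R`-renamings of the variables of `v`; the values of `r₁`, `r₂` on variables outside `v` play no
role. -/
inductive Derives {σ : Signature.{uS, uM, uV}} {R : ContextStructure σ.V}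
    (E : Set (REquation σ R)) : Word σ.V → ∀ {s : σ.S}, Term σ s → Term σ s → Prop
  | ax (e : REquation σ R) : e ∈ E → Derives E e.ctx e.lhs e.rhs
  | refl {v : Word σ.V} {s : σ.S} (t : Term σ s) : R.rel v t.tau → Derives E v t t
  | symm {v : Word σ.V} {s : σ.S} {t t' : Term σ s} : Derives E v t t' → Derives E v t' t
  | trans {v : Word σ.V} {s : σ.S} {t₁ t₂ t₃ : Term σ s} :
      Derives E v t₁ t₂ → Derives E v t₂ t₃ → Derives E v t₁ t₃
  | subst {v : Word σ.V} {s : σ.S} {t₁ t₂ : Term σ s} (r₁ r₂ : ∀ x : σ.V, Term σ (σ.vty x))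
      (w : Word σ.V) (w' : Fin v.len → Word σ.V) :
      Derives E v t₁ t₂ → R.rel w (Word.concat w') →
      (∀ i, R.rel (w' i) (r₁ (v.get i)).tau) → (∀ i, R.rel (w' i) (r₂ (v.get i)).tau) →
      (∀ i, Derives E (w' i) (r₁ (v.get i)) (r₂ (v.get i))) →
      Derives E w (t₁.subst r₁) (t₂.subst r₂)

/-- `E ⊢_R φ`. -/
def Proves {σ : Signature.{uS, uM, uV}} {R : ContextStructure σ.V} (E : Set (REquation σ R))
    (φ : REquation σ R) : Prop :=
  Derives E φ.ctx φ.lhs φ.rhs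

/-! ### Models in `Δ_R`-multicategories -/

/-- A `σ`-model in a multicategory. -/
@[ext]
structure Model (σ : Signature.{uS, uM, uV}) {Δ : StructureCategory}
    (C : DeltaMulticategory.{w, w'} Δ) where
  obj : σ.S → C.Obj
  op : ∀ f : σ.M, C.Hom ((σ.dom f).map obj) (obj (σ.cod f))

namespace Model

variable {σ : Signature.{uS, uM, uV}}

/-- The image of a model along a morphism of `Δ`-multicategories. -/
def map {Δ : StructureCategory} {C : DeltaMulticategory.{u, v} Δ}
    {D : DeltaMulticategory.{w, w'} Δ} (m : Model σ C) (T : C.Functor D) : Model σ D where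
  obj s := T.obj (m.obj s)
  op f := T.map (m.op f)

variable {R : ContextStructure σ.V} {C : DeltaMulticategory.{w, w'} (σ.delta R)}

/-- The word of objects `m_v` interpreting a word of variables. -/
def word (m : Model σ C) (v : Word σ.V) : Word C.Obj := v.map (fun x => m.obj (σ.vty x))

/-- The canonical morphism `g ↦ g * m_{v,w}`. -/
noncomputable def canon (m : Model σ C) {v w : Word σ.V} (h : R.rel v w) {b : C.Obj}
    (g : C.Hom (m.word w) b) : C.Hom (m.word v) b :=
  C.act (R.fn h) (R.fn_mem h) (m.word v).get b (castDom (R.map_eq_fn h _) g)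

/-- The interpretation `m_v(t) : m_v → m(b)` of a term `t : b` in an `R`-context `v`. -/
noncomputable def interp (m : Model σ C) (hR : R.Modelable) : ∀ {s : σ.S} (t : Term σ s)
    {v : Word σ.V}, R.rel v t.tau → C.Hom (m.word v) (m.obj s)
  | _, .var x, _, h => m.canon h (C.id (m.obj (σ.vty x)))
  | _, .app f t, _, h =>
    m.canon (hR.choice.rel_concat (v := fun i => (t i).tau) h)
      (C.comp (b := fun i => m.obj ((σ.dom f).get i)) (m.op f)
        (fun i => m.interp hR (t i) (hR.choice.rel_ctx (v := fun i => (t i).tau) h i)))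

/-- `m ⊨ φ`. -/
def Satisfies (m : Model σ C) (hR : R.Modelable) (φ : REquation σ R) : Prop :=
  m.interp hR φ.lhs φ.rel_lhs = m.interp hR φ.rhs φ.rel_rhs

/-- `m ⊨ E`. -/
def SatisfiesTheory (m : Model σ C) (hR : R.Modelable) (E : Set (REquation σ R)) : Prop :=
  ∀ φ ∈ E, m.Satisfies hR φ

end Model

/-! ### Models in sets of (cartesian) equational theories -/

/-- An equation in the usual, cartesian, sense. -/
abbrev CartEquation (σ : Signature.{uS, uM, uV}) : Type (max uS uM uV) :=
  REquation σ (ContextStructure.cartesian σ.V)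

/-- A model of a signature in sets. -/
structure SetModel (σ : Signature.{uS, uM, uV}) where
  carrier : σ.S → Type w
  op : ∀ f : σ.M, (∀ i : Fin (σ.dom f).len, carrier ((σ.dom f).get i)) → carrier (σ.cod f)

namespace SetModel

variable {σ : Signature.{uS, uM, uV}}

/-- The value of a term all of whose variables are in `U`, under an assignment of the variables
in `U`. -/
def eval (A : SetModel.{w} σ) {U : Set σ.V} (ρ : ∀ x ∈ U, A.carrier (σ.vty x)) :
    ∀ {s : σ.S} (t : Term σ s), Set.range t.tau.get ⊆ U → A.carrier s
  | _, .var x, h => ρ x (h ⟨(0 : Fin 1), rfl⟩)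
  | _, .app f t, h => A.op f (fun i => A.eval ρ (t i) (subset_trans
      (by rw [Term.tau, Word.range_concat]
          exact Set.subset_iUnion (fun i => Set.range (t i).tau.get) i) h))

/-- `A ⊨ φ`: both sides agree under all assignments of the variables of the context. -/
def Satisfies (A : SetModel.{w} σ) (φ : CartEquation σ) : Prop :=
  ∀ ρ : (∀ x ∈ Set.range φ.ctx.get, A.carrier (σ.vty x)),
    A.eval ρ φ.lhs φ.rel_lhs.2 = A.eval ρ φ.rhs φ.rel_rhs.2

/-- `A ⊨ T`. -/
def SatisfiesTheory (A : SetModel.{w} σ) (T : Set (CartEquation σ)) : Prop :=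
  ∀ φ ∈ T, A.Satisfies φ

/-- Morphisms of models in sets. -/
structure Hom (A : SetModel.{u} σ) (B : SetModel.{v} σ) where
  map : ∀ s, A.carrier s → B.carrier s
  map_op : ∀ (f : σ.M) (x : ∀ i : Fin (σ.dom f).len, A.carrier ((σ.dom f).get i)),
    map _ (A.op f x) = B.op f (fun i => map _ (x i))

/-- `A` is an initial object among the `T`-models in sets. -/
def IsInitialModel (A : SetModel.{w} σ) (T : Set (CartEquation σ)) : Prop :=
  A.SatisfiesTheory T ∧ ∀ B : SetModel.{w} σ, B.SatisfiesTheory T → Nonempty (Unique (A.Hom B))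

end SetModel

/-! ### The extended signature `Σ` -/

/-- Function symbols of the extended signature: composition symbols, identity symbols,
`Δ`-action symbols and internalized symbols of `σ`. -/
inductive ExtSymbol (σ : Signature.{uS, uM, uV}) (Δ : StructureCategory) : Type (max uS uM)
  | comp {n : ℕ} (b : Fin n → σ.S) (a : Fin n → Word σ.S) (c : σ.S)
  | id (c : σ.S)
  | act {m n : ℕ} (θ : Fin m → Fin n) (hθ : Δ.mem θ) (b : Fin n → σ.S) (c : σ.S)
  | op (f : σ.M)

namespace ExtSymbol

variable {σ : Signature.{uS, uM, uV}} {Δ : StructureCategory}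

/-- Domains of the symbols of the extended signature; `(b₁⋯bₙ, c)(a¹, b₁)⋯(aⁿ, bₙ)` for the
composition symbols. -/
def dom : ExtSymbol σ Δ → Word (Word σ.S × σ.S)
  | comp (n := n) b a c => ⟨n + 1, Fin.cons (⟨n, b⟩, c) (fun i => (a i, b i))⟩
  | id _ => Word.nil
  | act (m := m) θ _ b c => Word.single (⟨m, fun i => b (θ i)⟩, c)
  | op _ => Word.nil

/-- Codomains of the symbols of the extended signature. -/
def cod : ExtSymbol σ Δ → Word σ.S × σ.S
  | comp _ a c => (Word.concat a, c)
  | id c => (Word.single c, c)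
  | act (n := n) _ _ b c => (⟨n, b⟩, c)
  | op f => (σ.dom f, σ.cod f)

end ExtSymbol

/-- The extended signature `Σ` of `σ` and a structure category.  Its variables of sort `s` are the
pairs `(s, k)` with `k ∈ ℕ`. -/
def Signature.ext (σ : Signature.{uS, uM, uV}) (Δ : StructureCategory) :
    Signature.{uS, max uS uM, uS} where
  S := Word σ.S × σ.S
  M := ExtSymbol σ Δ
  V := (Word σ.S × σ.S) × ℕ
  dom := ExtSymbol.dom
  cod := ExtSymbol.cod
  vty := Prod.fst
  infinite_fiber s := Infinite.of_injective
    (fun k : ℕ => (⟨(s, k), rfl⟩ : {x : (Word σ.S × σ.S) × ℕ // x.1 = s}))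
    (fun k l h => by simpa using h)
  countable_fiber s := Function.Injective.countable
    (f := fun x : {x : (Word σ.S × σ.S) × ℕ // x.1 = s} => x.1.2)
    (fun x y h => Subtype.ext (Prod.ext (x.2.trans y.2.symm) h))

section ExtTerms

variable {σ : Signature.{uS, uM, uV}} {Δ : StructureCategory}

/-- `Σ`-terms of sort `(a, b)`. -/
abbrev ExtTerm (σ : Signature.{uS, uM, uV}) (Δ : StructureCategory) (a : Word σ.S) (b : σ.S) :
    Type (max uS uM) :=
  Term.{uS, max uS uM, uS} (σ.ext Δ) (a, b)

namespace ExtTerm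

/-- The term `∘(h, g₁, …, gₙ)`. -/
def comp {n : ℕ} {b : Fin n → σ.S} {a : Fin n → Word σ.S} {c : σ.S}
    (h : ExtTerm σ Δ ⟨n, b⟩ c) (g : ∀ i, ExtTerm σ Δ (a i) (b i)) :
    ExtTerm σ Δ (Word.concat a) c :=
  Term.app (σ := σ.ext Δ) (ExtSymbol.comp b a c)
    (Fin.cons (α := fun i : Fin (n + 1) => Term (σ.ext Δ)
      (((σ.ext Δ).dom (ExtSymbol.comp b a c)).get i)) h g)

/-- The term `id_c`. -/
def id (c : σ.S) : ExtTerm σ Δ (Word.single c) c :=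
  Term.app (σ := σ.ext Δ) (ExtSymbol.id c) (fun i => Fin.elim0 i)

/-- The term `θ_*(h)`. -/
def act {m n : ℕ} (θ : Fin m → Fin n) (hθ : Δ.mem θ) (b : Fin n → σ.S) (c : σ.S)
    (h : ExtTerm σ Δ ⟨m, fun i => b (θ i)⟩ c) : ExtTerm σ Δ ⟨n, b⟩ c :=
  Term.app (σ := σ.ext Δ) (ExtSymbol.act θ hθ b c) (fun _ => h)

/-- The internalized symbol `f`, as a term. -/
def op (f : σ.M) : ExtTerm σ Δ (σ.dom f) (σ.cod f) :=
  Term.app (σ := σ.ext Δ) (ExtSymbol.op f) (fun i => Fin.elim0 i)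

end ExtTerm

/-- All variables of `t` are in `U`. -/
def VarsIn (U : Set (σ.ext Δ).V) {a : Word σ.S} {b : σ.S} (t : ExtTerm σ Δ a b) : Prop :=
  Set.range t.tau.get ⊆ U

lemma varsIn_app {U : Set (σ.ext Δ).V} (f : (σ.ext Δ).M)
    (t : ∀ i, Term (σ.ext Δ) (((σ.ext Δ).dom f).get i)) :
    Set.range (Term.app f t).tau.get ⊆ U ↔ ∀ i, Set.range (t i).tau.get ⊆ U := by
  rw [Term.tau, Word.range_concat, Set.iUnion_subset_iff]

lemma VarsIn.comp {U : Set (σ.ext Δ).V} {n : ℕ} {b : Fin n → σ.S} {a : Fin n → Word σ.S}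
    {c : σ.S} {h : ExtTerm σ Δ ⟨n, b⟩ c} {g : ∀ i, ExtTerm σ Δ (a i) (b i)}
    (hh : VarsIn U h) (hg : ∀ i, VarsIn U (g i)) : VarsIn U (ExtTerm.comp h g) :=
  (varsIn_app _ _).2 (Fin.cases hh hg)

lemma VarsIn.id {U : Set (σ.ext Δ).V} (c : σ.S) : VarsIn U (ExtTerm.id c) :=
  (varsIn_app _ _).2 (fun i => Fin.elim0 i)

lemma VarsIn.op {U : Set (σ.ext Δ).V} (f : σ.M) : VarsIn U (ExtTerm.op f) :=
  (varsIn_app _ _).2 (fun i => Fin.elim0 i)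

lemma VarsIn.act {U : Set (σ.ext Δ).V} {m n : ℕ} {θ : Fin m → Fin n} {hθ : Δ.mem θ}
    {b : Fin n → σ.S} {c : σ.S} {h : ExtTerm σ Δ ⟨m, fun i => b (θ i)⟩ c} (hh : VarsIn U h) :
    VarsIn U (ExtTerm.act θ hθ b c h) :=
  (varsIn_app _ _).2 (fun _ => hh)

lemma VarsIn.cast {U : Set (σ.ext Δ).V} {a a' : Word σ.S} {c : σ.S} (e : a = a')
    {h : ExtTerm σ Δ a c} (hh : VarsIn U h) : VarsIn U (castDom e h) := by
  subst e; exact hh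

/-! Contexts indexed by a finite type `ι` enumerated by `e : ι ≃ Fin N`: the variable with index
`i`, of sort `s i`, is `(s i, e i)`; these variables are pairwise different. -/

/-- The context consisting of one variable for each `i : ι`. -/
def extCtx {ι : Type} {N : ℕ} (e : ι ≃ Fin N) (s : ι → Word σ.S × σ.S) : Word (σ.ext Δ).V :=
  ⟨N, fun k => (s (e.symm k), k.1)⟩

/-- The variable with index `i`, as a term. -/
def extVar {ι : Type} {N : ℕ} (e : ι ≃ Fin N) (s : ι → Word σ.S × σ.S) (i : ι) :
    ExtTerm σ Δ (s i).1 (s i).2 :=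
  Term.var (σ := σ.ext Δ) (s i, (e i).1)

lemma extCtx_injective {ι : Type} {N : ℕ} (e : ι ≃ Fin N) (s : ι → Word σ.S × σ.S) :
    Function.Injective (extCtx (Δ := Δ) e s).get := fun _ _ h =>
  Fin.ext (congrArg Prod.snd h)

lemma extVar_mem {ι : Type} {N : ℕ} (e : ι ≃ Fin N) (s : ι → Word σ.S × σ.S) (i : ι) :
    ((s i, (e i).1) : (σ.ext Δ).V) ∈ Set.range (extCtx (Δ := Δ) e s).get :=
  ⟨e i, by simp [extCtx]; rfl⟩

lemma VarsIn.var {ι : Type} {N : ℕ} (e : ι ≃ Fin N) (s : ι → Word σ.S × σ.S) (i : ι) :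
    VarsIn (Set.range (extCtx (Δ := Δ) e s).get) (extVar e s i) := by
  rintro _ ⟨_, rfl⟩
  exact extVar_mem e s i

/-- The equation `lhs ≈ rhs` in the context with index type `ι`. -/
def extEq {ι : Type} {N : ℕ} (e : ι ≃ Fin N) (s : ι → Word σ.S × σ.S) {a : Word σ.S} {b : σ.S}
    (lhs rhs : ExtTerm σ Δ a b) (hl : VarsIn (Set.range (extCtx (Δ := Δ) e s).get) lhs)
    (hr : VarsIn (Set.range (extCtx (Δ := Δ) e s).get) rhs) : CartEquation (σ.ext Δ) where
  ctx := extCtx e s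
  sort := (a, b)
  lhs := lhs
  rhs := rhs
  rel_lhs := ⟨extCtx_injective e s, hl⟩
  rel_rhs := ⟨extCtx_injective e s, hr⟩

/-- Index type and enumeration for contexts `h g₁ ⋯ gₙ`. -/
abbrev enum₂ (n : ℕ) : Fin 1 ⊕ Fin n ≃ Fin (1 + n) := finSumFinEquiv

/-- Index type and enumeration for contexts `h g₁ ⋯ gₙ f¹₁ ⋯ fⁿ_{mₙ}`. -/
abbrev enum₃ {n : ℕ} (m : Fin n → ℕ) :
    Fin 1 ⊕ (Fin n ⊕ (i : Fin n) × Fin (m i)) ≃ Fin (1 + (n + ∑ i, m i)) :=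
  (Equiv.sumCongr (Equiv.refl _)
    ((Equiv.sumCongr (Equiv.refl _) finSigmaFinEquiv).trans finSumFinEquiv)).trans finSumFinEquiv

/-! ### The categorization of `σ` -/

/-- Sorts of the variables in the associativity equation. -/
def assocSort {n : ℕ} {m : Fin n → ℕ} (c : Fin n → σ.S) (d : σ.S) (b : ∀ i, Fin (m i) → σ.S)
    (a : ∀ i, Fin (m i) → Word σ.S) :
    Fin 1 ⊕ (Fin n ⊕ (i : Fin n) × Fin (m i)) → Word σ.S × σ.S
  | .inl _ => (⟨n, c⟩, d)
  | .inr (.inl i) => (⟨m i, b i⟩, c i)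
  | .inr (.inr p) => (a p.1 p.2, b p.1 p.2)

/-- `∘(∘(h, g₁, …, gₙ), f¹₁, …, fⁿ_{mₙ}) ≈ ∘(h, ∘(g₁, f¹₁, …), …, ∘(gₙ, …, fⁿ_{mₙ}))`. -/
def assocEq {n : ℕ} {m : Fin n → ℕ} (c : Fin n → σ.S) (d : σ.S) (b : ∀ i, Fin (m i) → σ.S)
    (a : ∀ i, Fin (m i) → Word σ.S) : CartEquation (σ.ext Δ) :=
  let s := assocSort c d b a
  let x : ∀ i, ExtTerm σ Δ (s i).1 (s i).2 := extVar (enum₃ m) s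
  extEq (enum₃ m) s
    (castDom (Word.concat_concat a)
      (ExtTerm.comp (n := ∑ i, m i)
        (ExtTerm.comp (x (.inl 0)) (fun i => x (.inr (.inl i))))
        (fun k => x (.inr (.inr (finSigmaFinEquiv.symm k))))))
    (ExtTerm.comp (x (.inl 0))
      (fun i => ExtTerm.comp (x (.inr (.inl i))) (fun j => x (.inr (.inr ⟨i, j⟩)))))
    (by refine VarsIn.cast _ (VarsIn.comp (VarsIn.comp ?_ fun _ => ?_) fun _ => ?_) <;>
          exact VarsIn.var (enum₃ m) s _)
    (by refine VarsIn.comp ?_ fun _ => VarsIn.comp ?_ fun _ => ?_ <;>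
          exact VarsIn.var (enum₃ m) s _)

/-- `∘(id_d, h) ≈ h`. -/
def idCompEq (a : Word σ.S) (d : σ.S) : CartEquation (σ.ext Δ) :=
  let s : Fin 1 → Word σ.S × σ.S := fun _ => (a, d)
  let h : ExtTerm σ Δ a d := extVar (Equiv.refl (Fin 1)) s 0
  extEq (Equiv.refl (Fin 1)) s
    (castDom (Word.concat_one a) (ExtTerm.comp (ExtTerm.id d) (fun _ => h))) h
    (((VarsIn.id _).comp (fun _ => VarsIn.var _ s 0)).cast _) (VarsIn.var _ s 0)

/-- `∘(h, id_{c₁}, …, id_{cₙ}) ≈ h`. -/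
def compIdEq {n : ℕ} (c : Fin n → σ.S) (d : σ.S) : CartEquation (σ.ext Δ) :=
  let s : Fin 1 → Word σ.S × σ.S := fun _ => (⟨n, c⟩, d)
  let h : ExtTerm σ Δ ⟨n, c⟩ d := extVar (Equiv.refl (Fin 1)) s 0
  extEq (Equiv.refl (Fin 1)) s
    (castDom (Word.concat_single c) (ExtTerm.comp h (fun i => ExtTerm.id (c i)))) h
    (((VarsIn.var _ s 0).comp (fun _ => VarsIn.id _)).cast _) (VarsIn.var _ s 0)

/-- `(id_{[n]})_*(h) ≈ h`. -/
def actIdEq {n : ℕ} (c : Fin n → σ.S) (d : σ.S) : CartEquation (σ.ext Δ) :=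
  let s : Fin 1 → Word σ.S × σ.S := fun _ => (⟨n, c⟩, d)
  let h : ExtTerm σ Δ ⟨n, c⟩ d := extVar (Equiv.refl (Fin 1)) s 0
  extEq (Equiv.refl (Fin 1)) s (ExtTerm.act _root_.id (Δ.id_mem n) c d h) h
    (VarsIn.var _ s 0).act (VarsIn.var _ s 0)

/-- `(φ θ)_*(h') ≈ φ_*(θ_*(h'))`. -/
def actCompEq {k m n : ℕ} {θ : Fin k → Fin m} {φ : Fin m → Fin n} (hθ : Δ.mem θ) (hφ : Δ.mem φ)
    (c : Fin n → σ.S) (d : σ.S) : CartEquation (σ.ext Δ) :=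
  let s : Fin 1 → Word σ.S × σ.S := fun _ => (⟨k, fun i => c (φ (θ i))⟩, d)
  let h : ExtTerm σ Δ ⟨k, fun i => c (φ (θ i))⟩ d := extVar (Equiv.refl (Fin 1)) s 0
  extEq (Equiv.refl (Fin 1)) s (ExtTerm.act (φ ∘ θ) (Δ.comp_mem hθ hφ) c d h)
    (ExtTerm.act φ hφ c d (ExtTerm.act θ hθ (fun i => c (φ i)) d h))
    (by refine VarsIn.act ?_; exact VarsIn.var _ s 0)
    (by refine VarsIn.act (VarsIn.act ?_); exact VarsIn.var _ s 0)

/-- Sorts of the variables in the equation relating the action and composition on the left. -/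
def actLeftSort {m n : ℕ} (θ : Fin m → Fin n) (c : Fin n → σ.S) (d : σ.S)
    (a : Fin n → Word σ.S) : Fin 1 ⊕ Fin n → Word σ.S × σ.S
  | .inl _ => (⟨m, fun i => c (θ i)⟩, d)
  | .inr i => (a i, c i)

/-- `∘(θ_*(h'), g₁, …, gₙ) ≈ (θ'_{m₁, …, mₙ})_*(∘(h', g_{θ(1)}, …, g_{θ(m)}))`. -/
def actLeftEq {m n : ℕ} {θ : Fin m → Fin n} (hθ : Δ.mem θ) (c : Fin n → σ.S) (d : σ.S)
    (a : Fin n → Word σ.S) : CartEquation (σ.ext Δ) :=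
  let s := actLeftSort θ c d a
  let x : ∀ i, ExtTerm σ Δ (s i).1 (s i).2 := extVar (enum₂ n) s
  extEq (enum₂ n) s
    (ExtTerm.comp (ExtTerm.act θ hθ c d (x (.inl 0))) (fun i => x (.inr i)))
    (ExtTerm.act (finSimilarity θ (fun j => (a j).len)) (Δ.similarity_mem _ hθ)
      (Word.concat a).get d
      (castDom (Word.concat_similarity θ a)
        (ExtTerm.comp (x (.inl 0)) (fun i => x (.inr (θ i))))))
    (by refine VarsIn.comp (VarsIn.act ?_) fun _ => ?_ <;> exact VarsIn.var (enum₂ n) s _)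
    (by refine VarsIn.act (VarsIn.cast _ (VarsIn.comp ?_ fun _ => ?_)) <;>
          exact VarsIn.var (enum₂ n) s _)

/-- Sorts of the variables in the equation relating the action and composition on the right. -/
def actRightSort {n : ℕ} (k : Fin n → ℕ) (b : Fin n → σ.S) (c : σ.S) (a : Fin n → Word σ.S)
    (τ : ∀ i, Fin (k i) → Fin (a i).len) : Fin 1 ⊕ Fin n → Word σ.S × σ.S
  | .inl _ => (⟨n, b⟩, c)
  | .inr i => (⟨k i, fun j => (a i).get (τ i j)⟩, b i)

/-- `∘(h, θ¹_*(g'₁), …, θⁿ_*(g'ₙ)) ≈ (θ¹ + ⋯ + θⁿ)_*(∘(h, g'₁, …, g'ₙ))`. -/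
def actRightEq {n : ℕ} {k : Fin n → ℕ} (b : Fin n → σ.S) (c : σ.S) (a : Fin n → Word σ.S)
    {τ : ∀ i, Fin (k i) → Fin (a i).len} (hτ : ∀ i, Δ.mem (τ i)) : CartEquation (σ.ext Δ) :=
  let s := actRightSort k b c a τ
  let x : ∀ i, ExtTerm σ Δ (s i).1 (s i).2 := extVar (enum₂ n) s
  extEq (enum₂ n) s
    (ExtTerm.comp (x (.inl 0))
      (fun i => ExtTerm.act (τ i) (hτ i) (a i).get (b i) (x (.inr i))))
    (ExtTerm.act (finCoprod τ) (Δ.coprod_mem hτ) (Word.concat a).get c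
      (castDom (Word.concat_coprod a τ) (ExtTerm.comp (x (.inl 0)) (fun i => x (.inr i)))))
    (by refine VarsIn.comp ?_ fun _ => VarsIn.act ?_ <;> exact VarsIn.var (enum₂ n) s _)
    (by refine VarsIn.act (VarsIn.cast _ (VarsIn.comp ?_ fun _ => ?_)) <;>
          exact VarsIn.var (enum₂ n) s _)

/-- The categorization of `σ`: the `Σ`-theory whose equations are the axioms of
`Δ`-multicategories. -/
inductive Categorization (σ : Signature.{uS, uM, uV}) (Δ : StructureCategory) :
    CartEquation (σ.ext Δ) → Prop
  | assoc {n : ℕ} {m : Fin n → ℕ} (c : Fin n → σ.S) (d : σ.S) (b : ∀ i, Fin (m i) → σ.S)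
      (a : ∀ i, Fin (m i) → Word σ.S) : Categorization σ Δ (assocEq c d b a)
  | idComp (a : Word σ.S) (d : σ.S) : Categorization σ Δ (idCompEq a d)
  | compId {n : ℕ} (c : Fin n → σ.S) (d : σ.S) : Categorization σ Δ (compIdEq c d)
  | actId {n : ℕ} (c : Fin n → σ.S) (d : σ.S) : Categorization σ Δ (actIdEq c d)
  | actComp {k m n : ℕ} {θ : Fin k → Fin m} {φ : Fin m → Fin n} (hθ : Δ.mem θ) (hφ : Δ.mem φ)
      (c : Fin n → σ.S) (d : σ.S) : Categorization σ Δ (actCompEq hθ hφ c d)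
  | actLeft {m n : ℕ} {θ : Fin m → Fin n} (hθ : Δ.mem θ) (c : Fin n → σ.S) (d : σ.S)
      (a : Fin n → Word σ.S) : Categorization σ Δ (actLeftEq hθ c d a)
  | actRight {n : ℕ} {k : Fin n → ℕ} (b : Fin n → σ.S) (c : σ.S) (a : Fin n → Word σ.S)
      {τ : ∀ i, Fin (k i) → Fin (a i).len} (hτ : ∀ i, Δ.mem (τ i)) :
      Categorization σ Δ (actRightEq b c a hτ)

end ExtTerms

/-! ### Internalization of an `R`-theory -/

section Internalization

variable {σ : Signature.{uS, uM, uV}} {R : ContextStructure σ.V}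

/-- The pure `Σ`-term `N_v(t)` of sort `(a₁ ⋯ aₙ, b)`, for a term `t : b` in an `R`-context
`v = v₁ ⋯ vₙ` with `vᵢ : aᵢ`, formed with the choice `κ` of contexts of subterms. -/
noncomputable def internalize (κ : R.ContextChoice) : ∀ {s : σ.S} (t : Term σ s) {v : Word σ.V},
    R.rel v t.tau → ExtTerm σ (σ.delta R) (v.map σ.vty) s
  | _, .var x, v, h =>
    ExtTerm.act (R.fn h) (R.fn_mem h) (v.map σ.vty).get _
      (castDom (R.map_eq_fn h _) (ExtTerm.id (σ.vty x)))
  | _, .app f t, v, h =>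
    ExtTerm.act (R.fn (κ.rel_concat (v := fun i => (t i).tau) h)) (R.fn_mem _)
      (v.map σ.vty).get _
      (castDom (R.map_eq_fn (κ.rel_concat (v := fun i => (t i).tau) h) _)
        (ExtTerm.comp (b := (σ.dom f).get) (ExtTerm.op f)
          (fun i => internalize κ (t i) (κ.rel_ctx (v := fun i => (t i).tau) h i))))

lemma varsIn_internalize (κ : R.ContextChoice) (U : Set (σ.ext (σ.delta R)).V) {s : σ.S}
    (t : Term σ s) {v : Word σ.V} (h : R.rel v t.tau) : VarsIn U (internalize κ t h) := by
  induction t generalizing v with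
  | var x => exact ((VarsIn.id _).cast _).act
  | app f t ih => exact (((VarsIn.op f).comp (fun i => ih i _)).cast _).act

/-- The `Σ`-equation `N_v(t₁) ≈_() N_v(t₂)` for an `R`-equation `t₁ ≈_v t₂`. -/
noncomputable def internalizeEq (κ : R.ContextChoice) (φ : REquation σ R) :
    CartEquation (σ.ext (σ.delta R)) where
  ctx := Word.nil
  sort := (φ.ctx.map σ.vty, φ.sort)
  lhs := internalize κ φ.lhs φ.rel_lhs
  rhs := internalize κ φ.rhs φ.rel_rhs
  rel_lhs := ⟨fun i => Fin.elim0 i, varsIn_internalize κ _ _ _⟩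
  rel_rhs := ⟨fun i => Fin.elim0 i, varsIn_internalize κ _ _ _⟩

/-- The multicategorical `E`-theory: the categorization of `σ` together with the internalized
equations of `E`. -/
def multicatTheory (κ : R.ContextChoice) (E : Set (REquation σ R)) :
    Set (CartEquation (σ.ext (σ.delta R))) :=
  {e | Categorization σ (σ.delta R) e} ∪ internalizeEq κ '' E

end Internalization

/-! ### From `Σ`-models in sets to `Δ`-multicategories -/

namespace SetModel

variable {σ : Signature.{uS, uM, uV}} {Δ : StructureCategory}

/-- The set `C(a, b)` of a `Σ`-model. -/
abbrev hom (A : SetModel.{w} (σ.ext Δ)) (a : Word σ.S) (b : σ.S) : Type w := A.carrier (a, b)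

/-- The composition operation of a `Σ`-model. -/
def compOp (A : SetModel.{w} (σ.ext Δ)) {n : ℕ} {b : Fin n → σ.S} {a : Fin n → Word σ.S}
    {c : σ.S} (h : A.hom ⟨n, b⟩ c) (g : ∀ i, A.hom (a i) (b i)) : A.hom (Word.concat a) c :=
  A.op (ExtSymbol.comp b a c)
    (Fin.cons (α := fun i : Fin (n + 1) => A.carrier
      (((σ.ext Δ).dom (ExtSymbol.comp b a c)).get i)) h g)

/-- The identities of a `Σ`-model. -/
def idOp (A : SetModel.{w} (σ.ext Δ)) (c : σ.S) : A.hom (Word.single c) c :=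
  A.op (ExtSymbol.id c) (fun i => Fin.elim0 i)

/-- The action of `Δ` in a `Σ`-model. -/
def actOp (A : SetModel.{w} (σ.ext Δ)) {m n : ℕ} (θ : Fin m → Fin n) (hθ : Δ.mem θ)
    (b : Fin n → σ.S) (c : σ.S) (h : A.hom ⟨m, fun i => b (θ i)⟩ c) : A.hom ⟨n, b⟩ c :=
  A.op (ExtSymbol.act θ hθ b c) (fun _ => h)

/-- The interpretation of an internalized symbol of `σ` in a `Σ`-model. -/
def symbolOp (A : SetModel.{w} (σ.ext Δ)) (f : σ.M) : A.hom (σ.dom f) (σ.cod f) :=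
  A.op (ExtSymbol.op f) (fun i => Fin.elim0 i)

section Eval

variable (A : SetModel.{w} (σ.ext Δ)) {U : Set (σ.ext Δ).V}
  (ρ : ∀ x ∈ U, A.carrier ((σ.ext Δ).vty x))

/-- The value of a `Σ`-term. -/
abbrev evalT {a : Word σ.S} {b : σ.S} (t : ExtTerm σ Δ a b) (h : VarsIn U t) : A.hom a b :=
  A.eval ρ t h

lemma eval_comp {n : ℕ} {b : Fin n → σ.S} {a : Fin n → Word σ.S} {c : σ.S}
    (h : ExtTerm σ Δ ⟨n, b⟩ c) (g : ∀ i, ExtTerm σ Δ (a i) (b i))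
    (H : VarsIn U (ExtTerm.comp h g)) :
    A.evalT ρ (ExtTerm.comp h g) H = A.compOp (A.evalT ρ h ((varsIn_app _ _).1 H (0 : Fin (n + 1))))
      (fun i => A.evalT ρ (g i) ((varsIn_app _ _).1 H (i.succ : Fin (n + 1)))) := by
  refine congrArg (A.op (ExtSymbol.comp b a c)) ?_
  funext i
  refine Fin.cases ?_ (fun i => ?_) i <;> rfl

lemma eval_act {m n : ℕ} {θ : Fin m → Fin n} {hθ : Δ.mem θ}
    {b : Fin n → σ.S} {c : σ.S} (h : ExtTerm σ Δ ⟨m, fun i => b (θ i)⟩ c)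
    (H : VarsIn U (ExtTerm.act θ hθ b c h)) :
    A.evalT ρ (ExtTerm.act θ hθ b c h) H =
      A.actOp θ hθ b c (A.evalT ρ h ((varsIn_app _ _).1 H (0 : Fin 1))) := rfl

lemma eval_id (c : σ.S) (H : VarsIn U (ExtTerm.id c)) :
    A.evalT ρ (ExtTerm.id c) H = A.idOp c := by
  refine congrArg (A.op (ExtSymbol.id c)) ?_
  funext i
  exact Fin.elim0 i

lemma eval_cast {a a' : Word σ.S} {c : σ.S} (e : a = a') (h : ExtTerm σ Δ a c)
    (H : VarsIn U (castDom e h)) :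
    A.evalT ρ (castDom e h) H = castDom e (A.evalT ρ h (by subst e; exact H)) := by
  subst e; rfl

end Eval

/-- The assignment of given elements to the variables of an indexed context. -/
noncomputable def assign (A : SetModel.{w} (σ.ext Δ)) {ι : Type} {N : ℕ} (e : ι ≃ Fin N)
    (s : ι → Word σ.S × σ.S) (el : ∀ i, A.carrier (s i)) :
    ∀ x ∈ Set.range (extCtx (Δ := Δ) e s).get, A.carrier ((σ.ext Δ).vty x) :=
  fun _ hx => cast (congrArg (fun y => A.carrier ((σ.ext Δ).vty y)) hx.choose_spec)
    (el (e.symm hx.choose))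

lemma eval_var (A : SetModel.{w} (σ.ext Δ)) {ι : Type} {N : ℕ} (e : ι ≃ Fin N)
    (s : ι → Word σ.S × σ.S) (el : ∀ i, A.carrier (s i)) (i : ι)
    (H : VarsIn (Set.range (extCtx (Δ := Δ) e s).get) (extVar e s i)) :
    A.evalT (A.assign e s el) (extVar e s i) H = el i := by
  change cast _ (el (e.symm (extVar_mem (Δ := Δ) e s i).choose)) = el i
  have h := (extVar_mem (Δ := Δ) e s i).choose_spec
  have h2 : (extVar_mem (Δ := Δ) e s i).choose = e i := Fin.ext (congrArg Prod.snd h)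
  refine eq_of_heq ((cast_heq _ _).trans ?_)
  rw [h2, Equiv.symm_apply_apply]

/-- The `Δ`-multicategory with set of objects `S` given by a model in sets of the categorization
of `σ`. -/
noncomputable def toMulticategory (A : SetModel.{w} (σ.ext Δ))
    (hA : A.SatisfiesTheory {e | Categorization σ Δ e}) : DeltaMulticategory.{uS, w} Δ where
  Obj := σ.S
  Hom := A.hom
  comp := A.compOp
  id := A.idOp
  act := A.actOp
  assoc := by
    intro n m c d b a h g f
    let el : ∀ i, A.carrier (assocSort c d b a i) := fun i => match i with
      | .inl _ => h
      | .inr (.inl i) => g i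
      | .inr (.inr p) => f p.1 p.2
    have := hA _ (.assoc c d b a) (A.assign (enum₃ m) (assocSort c d b a) el)
    have ev := A.eval_var (enum₃ m) (assocSort c d b a) el
    refine Eq.trans (Eq.symm ?_) (this.trans ?_)
    · refine (A.eval_cast _ _ _ _).trans (congrArg _ ((A.eval_comp _ _ _ _).trans ?_))
      refine congrArg₂ A.compOp ((A.eval_comp _ _ _ _).trans ?_) (funext fun k => ev _ _)
      exact congrArg₂ A.compOp (ev _ _) (funext fun k => ev _ _)
    · refine (A.eval_comp _ _ _ _).trans (congrArg₂ A.compOp (ev _ _) (funext fun i => ?_))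
      refine (A.eval_comp _ _ _ _).trans ?_
      exact congrArg₂ A.compOp (ev _ _) (funext fun k => ev _ _)
  comp_id := by
    intro n c d h
    let s : Fin 1 → Word σ.S × σ.S := fun _ => (⟨n, c⟩, d)
    have := hA _ (.compId c d) (A.assign (Equiv.refl (Fin 1)) s (fun _ => h))
    have ev := A.eval_var (Equiv.refl (Fin 1)) s (fun _ => h) 0
    refine Eq.trans (Eq.symm ?_) (this.trans (ev _))
    refine (A.eval_cast _ _ _ _).trans (congrArg _ ((A.eval_comp _ _ _ _).trans ?_))
    exact congrArg₂ A.compOp (ev _) (funext fun k => A.eval_id _ _ _)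
  id_comp := by
    intro a d h
    let s : Fin 1 → Word σ.S × σ.S := fun _ => (a, d)
    have := hA _ (.idComp a d) (A.assign (Equiv.refl (Fin 1)) s (fun _ => h))
    have ev := A.eval_var (Equiv.refl (Fin 1)) s (fun _ => h) 0
    refine Eq.trans (Eq.symm ?_) (this.trans (ev _))
    refine (A.eval_cast _ _ _ _).trans (congrArg _ ((A.eval_comp _ _ _ _).trans ?_))
    exact congrArg₂ A.compOp (A.eval_id _ _ _) (funext fun k => ev _)
  act_id := by
    intro n c d h
    let s : Fin 1 → Word σ.S × σ.S := fun _ => (⟨n, c⟩, d)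
    have := hA _ (.actId c d) (A.assign (Equiv.refl (Fin 1)) s (fun _ => h))
    have hv := VarsIn.var (Δ := Δ) (Equiv.refl (Fin 1)) s 0
    have ev := A.eval_var (Equiv.refl (Fin 1)) s (fun _ => h) 0
    exact Eq.trans (Eq.symm (congrArg (A.actOp _ (Δ.id_mem n) c d) (ev hv))) (this.trans (ev hv))
  act_comp := by
    intro k m n θ φ hθ hφ c d h
    let s : Fin 1 → Word σ.S × σ.S := fun _ => (⟨k, fun i => c (φ (θ i))⟩, d)
    have := hA _ (.actComp hθ hφ c d) (A.assign (Equiv.refl (Fin 1)) s (fun _ => h))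
    have hv := VarsIn.var (Δ := Δ) (Equiv.refl (Fin 1)) s 0
    have ev := A.eval_var (Equiv.refl (Fin 1)) s (fun _ => h) 0
    refine Eq.trans (Eq.symm (congrArg (A.actOp _ (Δ.comp_mem hθ hφ) c d) (ev hv)))
      (this.trans ?_)
    exact congrArg (fun x => A.actOp φ hφ c d (A.actOp θ hθ _ d x)) (ev hv)
  comp_act := by
    intro n k b c a τ hτ h g
    let el : ∀ i, A.carrier (actRightSort k b c a τ i) := fun i => match i with
      | .inl _ => h
      | .inr i => g i
    have := hA _ (.actRight b c a hτ) (A.assign (enum₂ n) (actRightSort k b c a τ) el)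
    have ev := A.eval_var (enum₂ n) (actRightSort k b c a τ) el
    refine Eq.trans (Eq.symm ?_) (this.trans ?_)
    · refine (A.eval_comp _ _ _ _).trans (congrArg₂ A.compOp (ev _ _) (funext fun i => ?_))
      exact (A.eval_act _ _ _).trans (congrArg (A.actOp (τ i) (hτ i) (a i).get (b i)) (ev _ _))
    · refine (A.eval_act _ _ _).trans
        (congrArg (A.actOp _ (Δ.coprod_mem hτ) (Word.concat a).get c) ?_)
      refine (A.eval_cast _ _ _ _).trans (congrArg _ ((A.eval_comp _ _ _ _).trans ?_))
      exact congrArg₂ A.compOp (ev _ _) (funext fun k => ev _ _)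
  act_comp' := by
    intro m n θ hθ c d a h g
    let el : ∀ i, A.carrier (actLeftSort θ c d a i) := fun i => match i with
      | .inl _ => h
      | .inr i => g i
    have := hA _ (.actLeft hθ c d a) (A.assign (enum₂ n) (actLeftSort θ c d a) el)
    have ev := A.eval_var (enum₂ n) (actLeftSort θ c d a) el
    refine Eq.trans (Eq.symm ?_) (this.trans ?_)
    · refine (A.eval_comp _ _ _ _).trans (congrArg₂ A.compOp ?_ (funext fun i => ev _ _))
      exact (A.eval_act _ _ _).trans (congrArg (A.actOp θ hθ c d) (ev _ _))
    · refine (A.eval_act _ _ _).trans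
        (congrArg (A.actOp _ (Δ.similarity_mem _ hθ) (Word.concat a).get d) ?_)
      refine (A.eval_cast _ _ _ _).trans (congrArg _ ((A.eval_comp _ _ _ _).trans ?_))
      exact congrArg₂ A.compOp (ev _ _) (funext fun k => ev _ _)

/-- The `σ`-model in the multicategory of a `Σ`-model: a sort is interpreted as itself, and a
symbol of `σ` as the value of the corresponding internalized symbol. -/
noncomputable def toModel (A : SetModel.{w} (σ.ext Δ))
    (hA : A.SatisfiesTheory {e | Categorization σ Δ e}) : Model σ (A.toMulticategory hA) where
  obj := fun s => s
  op := A.symbolOp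

lemma IsInitialModel.categorization {R : ContextStructure σ.V} {κ : R.ContextChoice}
    {E : Set (REquation σ R)} {C : SetModel.{w} (σ.ext (σ.delta R))}
    (hC : C.IsInitialModel (multicatTheory κ E)) :
    C.SatisfiesTheory {e | Categorization σ (σ.delta R) e} :=
  fun e he => hC.1 e (Or.inl he)

end SetModel

/-! An initial model exists for the classical reason: variable-free terms modulo the congruence
generated by the closed instances of the equations. A σ-model `n` in any multicategory `D` gives a
set model of the categorization by pulling the hom-sets of `D` back along the objects `n` assigns to
sorts (`ofModel`). Morphisms from `C` into it amount to functors carrying the tautological model to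
`n`, so initiality in sets becomes initiality among multicategories (`existsUnique_functor`).

Matching internalized equations with satisfaction, and soundness, both rest on a normal form of the
interpretation. In `lin` distinct occurrences of a variable are distinct inputs, and by
`interp_eq_canon_lin` every interpretation is `lin` followed by one reindexing, so intermediate
contexts do not matter. Reindexings compose coherently because a context has no repetitions: the
function expressing a word in it is unique. The substitution lemma `interp_subst` follows, and then
soundness `interp_eq_of_derives` by induction on derivations.

Completeness needs no analysis of `C`. It suffices to have one `E`-model satisfying exactly the
derivable equations (`model_satisfies_iff`), since the functor from `C` carries satisfaction there.
It lives in a multicategory of operations on tuples of terms, cut out and identified by a logical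
relation `HomRel`: derivably equal arguments must have derivably equal values. An operation need not
be given by a term. Modelability is what closes these operations under composition. -/

/-! ### Initial models of cartesian theories in sets -/

/-- Variable-free terms of a given sort. -/
inductive ClosedTerm (σ : Signature.{uS, uM, uV}) : σ.S → Type (max uS uM)
  | app (f : σ.M) (t : ∀ i : Fin (σ.dom f).len, ClosedTerm σ ((σ.dom f).get i)) :
      ClosedTerm σ (σ.cod f)

namespace SetModel

variable {σ : Signature.{uS, uM, uV}}

@[ext]
lemma Hom.ext {A : SetModel.{u} σ} {B : SetModel.{v} σ} {f g : A.Hom B}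
    (h : ∀ s x, f.map s x = g.map s x) : f = g := by
  obtain ⟨f, _⟩ := f
  obtain ⟨g, _⟩ := g
  have : f = g := funext fun s => funext fun x => h s x
  subst this
  rfl

/-- The identity morphism. -/
def Hom.id (A : SetModel.{u} σ) : A.Hom A := ⟨fun _ x => x, fun _ _ => rfl⟩

/-- Composition of morphisms of models in sets. -/
def Hom.comp {A : SetModel.{u} σ} {B : SetModel.{v} σ} {C : SetModel.{w} σ} (g : B.Hom C)
    (f : A.Hom B) : A.Hom C :=
  ⟨fun s x => g.map s (f.map s x), fun k x => by rw [f.map_op, g.map_op]⟩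

lemma Hom.map_eval {A : SetModel.{u} σ} {B : SetModel.{v} σ} (f : A.Hom B) {U : Set σ.V}
    (ρ : ∀ x ∈ U, A.carrier (σ.vty x)) {s : σ.S} (t : Term σ s)
    (h : Set.range t.tau.get ⊆ U) :
    f.map s (A.eval ρ t h) = B.eval (fun x hx => f.map _ (ρ x hx)) t h := by
  induction t with
  | var x => rfl
  | app k t ih =>
    rw [eval, f.map_op, eval]
    exact congrArg _ (funext fun i => ih i _)

/-- The model of variable-free terms. -/
def closed (σ : Signature.{uS, uM, uV}) : SetModel.{max uS uM} σ := ⟨ClosedTerm σ, ClosedTerm.app⟩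

/-- The value of a variable-free term. -/
def evalClosed (A : SetModel.{w} σ) : ∀ {s : σ.S}, ClosedTerm σ s → A.carrier s
  | _, .app f t => A.op f (fun i => A.evalClosed (t i))

/-- Evaluation of variable-free terms as a morphism. -/
def closedHom (A : SetModel.{w} σ) : (closed σ).Hom A := ⟨fun _ t => A.evalClosed t, fun _ _ => rfl⟩

/-- The congruence on variable-free terms generated by the instances of the equations of `T`. -/
inductive Cong (T : Set (CartEquation σ)) : ∀ {s : σ.S}, ClosedTerm σ s → ClosedTerm σ s → Prop
  | ax (e : CartEquation σ) (he : e ∈ T)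
      (ρ : ∀ x ∈ Set.range e.ctx.get, (closed σ).carrier (σ.vty x)) :
      Cong T ((closed σ).eval ρ e.lhs e.rel_lhs.2) ((closed σ).eval ρ e.rhs e.rel_rhs.2)
  | refl {s : σ.S} (t : ClosedTerm σ s) : Cong T t t
  | symm {s : σ.S} {t t' : ClosedTerm σ s} : Cong T t t' → Cong T t' t
  | trans {s : σ.S} {t₁ t₂ t₃ : ClosedTerm σ s} : Cong T t₁ t₂ → Cong T t₂ t₃ → Cong T t₁ t₃
  | app (f : σ.M) {t t' : ∀ i : Fin (σ.dom f).len, ClosedTerm σ ((σ.dom f).get i)} :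
      (∀ i, Cong T (t i) (t' i)) → Cong T (.app f t) (.app f t')

/-- Congruence of variable-free terms as an equivalence relation. -/
def congSetoid (T : Set (CartEquation σ)) (s : σ.S) : Setoid (ClosedTerm σ s) :=
  ⟨Cong T, Cong.refl, Cong.symm, Cong.trans⟩

/-- The model of congruence classes of variable-free terms. -/
noncomputable def termModel (T : Set (CartEquation σ)) : SetModel.{max uS uM} σ where
  carrier s := Quotient (congSetoid T s)
  -- Representatives are chosen because the arguments form a dependent family of classes; by
  -- `Cong.app` the result does not depend on them.
  op f x := Quotient.mk (congSetoid T _) (.app f fun i => (x i).out)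

/-- The projection of variable-free terms to their classes. -/
noncomputable def closedToTermModel (T : Set (CartEquation σ)) : (closed σ).Hom (termModel T) where
  map s t := Quotient.mk (congSetoid T s) t
  map_op f x := Quotient.sound (s := congSetoid T _)
    (Cong.app f fun i => (Quotient.mk_out (s := congSetoid T _) (x i)).symm)

/-- An assignment of classes lifts to variable-free terms, and projection commutes with evaluation;
what remains is a generating instance of the congruence. -/
lemma termModel_satisfiesTheory (T : Set (CartEquation σ)) : (termModel T).SatisfiesTheory T := by
  intro e he ρ
  obtain ⟨ρ, rfl⟩ : ∃ ρ' : ∀ x ∈ Set.range e.ctx.get, (closed σ).carrier (σ.vty x),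
      ρ = fun x hx => (closedToTermModel T).map _ (ρ' x hx) :=
    ⟨fun x hx => Quotient.out (s := congSetoid T _) (ρ x hx),
      funext fun x => funext fun hx => (Quotient.out_eq (s := congSetoid T _) _).symm⟩
  rw [← Hom.map_eval, ← Hom.map_eval]
  exact Quotient.sound (s := congSetoid T _) (Cong.ax e he _)

lemma evalClosed_eq_of_cong {T : Set (CartEquation σ)} {A : SetModel.{w} σ}
    (hA : A.SatisfiesTheory T) {s : σ.S} {t t' : ClosedTerm σ s} (h : Cong T t t') :
    A.evalClosed t = A.evalClosed t' := by
  induction h with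
  | ax e he ρ =>
    have := hA e he (fun x hx => A.closedHom.map _ (ρ x hx))
    rwa [← Hom.map_eval, ← Hom.map_eval] at this
  | refl => rfl
  | symm _ ih => exact ih.symm
  | trans _ _ ih₁ ih₂ => exact ih₁.trans ih₂
  | app f _ ih => exact congrArg (A.op f) (funext ih)

/-- The morphism from the term model to a model of the theory. -/
noncomputable def termModelHom {T : Set (CartEquation σ)} (A : SetModel.{w} σ)
    (hA : A.SatisfiesTheory T) : (termModel T).Hom A where
  map s := Quotient.lift (s := congSetoid T s) (fun t => A.evalClosed t)
    fun _ _ h => evalClosed_eq_of_cong hA h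
  map_op f x := by
    refine congrArg (A.op f) (funext fun i => ?_)
    conv_rhs => rw [← Quotient.out_eq (x i)]
    rfl

/-- After composition with the projection both maps are morphisms out of variable-free terms, and
these are determined by recursion on the term. -/
lemma termModel_hom_ext {T : Set (CartEquation σ)} {A : SetModel.{w} σ}
    (f g : (termModel T).Hom A) : f = g := by
  ext s x
  induction x using Quotient.inductionOn with
  | _ t =>
  change (f.comp (closedToTermModel T)).map s t = (g.comp (closedToTermModel T)).map s t
  induction t with
  | app k t ih =>
    refine ((f.comp (closedToTermModel T)).map_op k t).trans
      (Eq.trans ?_ ((g.comp (closedToTermModel T)).map_op k t).symm)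
    exact congrArg _ (funext ih)

lemma termModel_isInitialModel (T : Set (CartEquation σ)) :
    (termModel T).IsInitialModel T :=
  ⟨termModel_satisfiesTheory T, fun B hB =>
    ⟨⟨⟨termModelHom B hB⟩, fun _ => termModel_hom_ext _ _⟩⟩⟩

/-- A model which is initial among the models in one universe is initial among all models. -/
lemma IsInitialModel.exists_hom {T : Set (CartEquation σ)} {C : SetModel.{max uS uM} σ}
    (hC : C.IsInitialModel T) (B : SetModel.{w} σ) (hB : B.SatisfiesTheory T) :
    Nonempty (Unique (C.Hom B)) := by
  -- `IsInitialModel` only tests models in the universe of `C`. The term model lies in that universe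
  -- and maps uniquely to models in every universe, so `C` is exhibited as a retract of it.
  obtain ⟨⟨⟨i⟩, _⟩⟩ := hC.2 (termModel T) (termModel_satisfiesTheory T)
  obtain ⟨hu⟩ := hC.2 C hC.1
  let j := termModelHom C hC.1
  have hij : j.comp i = Hom.id C := (hu.2 _).trans (hu.2 _).symm
  have key (f : C.Hom B) : f = (f.comp j).comp i := by
    conv_lhs => rw [show f = f.comp (Hom.id C) from rfl, ← hij]
    rfl
  refine ⟨⟨⟨(termModelHom B hB).comp i⟩, fun f => ?_⟩⟩
  rw [key f, termModel_hom_ext (f.comp j) (termModelHom B hB)]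
  rfl

end SetModel

/-! ### Reindexing and the linear interpretation of terms -/

lemma castDom_heq {α : Type u} {β : Type v} {H : Word α → β → Type w} {a a' : Word α} {b : β}
    (h : a = a') (f : H a b) : HEq (castDom h f) f := by
  subst h; rfl

namespace DeltaMulticategory

variable {Δ : StructureCategory} (C : DeltaMulticategory.{w, w'} Δ)

lemma comp_heq {n : ℕ} {b : Fin n → C.Obj} {a a' : Fin n → Word C.Obj} {c : C.Obj}
    (g : C.Hom ⟨n, b⟩ c) {f : ∀ i, C.Hom (a i) (b i)} {f' : ∀ i, C.Hom (a' i) (b i)}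
    (ha : ∀ i, a i = a' i) (hf : ∀ i, HEq (f i) (f' i)) : HEq (C.comp g f) (C.comp g f') := by
  obtain rfl : a = a' := funext ha
  obtain rfl : f = f' := funext fun i => eq_of_heq (hf i)
  rfl

/-- The action of `θ` on a multimorphism whose domain is equal to the reindexed domain. -/
def reindex {a a' : Word C.Obj} {b : C.Obj} (θ : Fin a'.len → Fin a.len) (hθ : Δ.mem θ)
    (e : a' = ⟨a'.len, fun i => a.get (θ i)⟩) (g : C.Hom a' b) : C.Hom a b :=
  C.act θ hθ a.get b (castDom e g)

/-- The equations between words identify the letters of `a'` and `a''` with reindexed letters of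
`a`; once they are substituted the transports vanish and `act_comp` remains. -/
lemma reindex_reindex {a a' a'' : Word C.Obj} {b : C.Obj} {τ : Fin a'.len → Fin a.len}
    {σ : Fin a''.len → Fin a'.len} (hτ : Δ.mem τ) (hσ : Δ.mem σ)
    (e : a' = ⟨a'.len, fun i => a.get (τ i)⟩) (e' : a'' = ⟨a''.len, fun i => a'.get (σ i)⟩)
    (e'' : a'' = ⟨a''.len, fun i => a.get ((τ ∘ σ) i)⟩) (g : C.Hom a'' b) :
    C.reindex τ hτ e (C.reindex σ hσ e' g) = C.reindex (τ ∘ σ) (Δ.comp_mem hσ hτ) e'' g := by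
  obtain ⟨n, a⟩ := a
  obtain ⟨m, a'⟩ := a'
  obtain ⟨k, a''⟩ := a''
  change Fin m → Fin n at τ
  change Fin k → Fin m at σ
  obtain rfl : a' = fun i => a (τ i) := eq_of_heq (Word.mk.inj e).2
  obtain rfl : a'' = fun i => a (τ (σ i)) := eq_of_heq (Word.mk.inj e').2
  exact (C.act_comp hσ hτ g).symm

lemma comp_reindex {n : ℕ} {b : Fin n → C.Obj} {c : C.Obj} {a u : Fin n → Word C.Obj}
    {σ : ∀ i, Fin (u i).len → Fin (a i).len} (hσ : ∀ i, Δ.mem (σ i))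
    (e : ∀ i, u i = ⟨(u i).len, fun j => (a i).get (σ i j)⟩)
    (e' : Word.concat u =
      ⟨(Word.concat u).len, fun x => (Word.concat a).get (finCoprod σ x)⟩)
    (g : C.Hom ⟨n, b⟩ c) (f : ∀ i, C.Hom (u i) (b i)) :
    C.comp g (fun i => C.reindex (σ i) (hσ i) (e i) (f i)) =
      C.reindex (a := Word.concat a) (a' := Word.concat u) (finCoprod σ) (Δ.coprod_mem hσ) e'
        (C.comp g f) := by
  obtain ⟨k, x, rfl⟩ : ∃ (k : Fin n → ℕ) (x : ∀ i, Fin (k i) → C.Obj), u = fun i => ⟨k i, x i⟩ :=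
    ⟨fun i => (u i).len, fun i => (u i).get, rfl⟩
  change ∀ i, Fin (k i) → Fin (a i).len at σ
  obtain rfl : x = fun i j => (a i).get (σ i j) :=
    funext fun i => eq_of_heq (Word.mk.inj (e i)).2
  exact C.comp_act hσ g f

end DeltaMulticategory

/-- A context has no repeated letter, so a position is determined by its letter. This uniqueness
settles all coherence questions between composite reindexings. -/
lemma ContextStructure.eq_fn_of_get {V : Type u} (R : ContextStructure V) {v w : Word V}
    (h : R.rel v w) {θ : Fin w.len → Fin v.len} (hθ : ∀ i, v.get (θ i) = w.get i) :
    θ = R.fn h :=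
  funext fun i => R.context h ((hθ i).trans (R.get_fn h i).symm)

namespace Term

variable {σ : Signature.{uS, uM, uV}}

lemma tau_subst (r : ∀ x : σ.V, Term σ (σ.vty x)) {s : σ.S} (t : Term σ s) :
    (t.subst r).tau = Word.concat (fun i => (r (t.tau.get i)).tau) := by
  induction t with
  | var x => exact (Word.concat_one _).symm
  | app f t ih =>
    rw [subst, tau]
    simp only [ih]
    exact (Word.concat_concat (fun i j => (r ((t i).tau.get j)).tau)).symm

lemma subst_var {s : σ.S} (t : Term σ s) : t.subst Term.var = t := by
  induction t with
  | var x => rfl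
  | app f t ih => exact congrArg _ (funext ih)

end Term

/-- In the substitution case, `R.trans` first places the substituted words in `w`, and `R.subst`
then passes from `v` to the variables of the terms. -/
lemma Derives.rel {σ : Signature.{uS, uM, uV}} {R : ContextStructure σ.V} {E : Set (REquation σ R)}
    {v : Word σ.V} {s : σ.S} {t t' : Term σ s} (h : Derives E v t t') :
    R.rel v t.tau ∧ R.rel v t'.tau := by
  induction h with
  | ax e _ => exact ⟨e.rel_lhs, e.rel_rhs⟩
  | refl t h => exact ⟨h, h⟩
  | symm _ ih => exact ih.symm
  | trans _ _ ih₁ ih₂ => exact ⟨ih₁.1, ih₂.2⟩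
  | subst r₁ r₂ w w' _ hw h₁ h₂ _ ih _ =>
    rw [Term.tau_subst, Term.tau_subst]
    exact ⟨R.subst (fun x => (r₁ x).tau) ih.1 (R.trans hw h₁),
      R.subst (fun x => (r₂ x).tau) ih.2 (R.trans hw h₂)⟩

/-! ### Coherence of reindexing, the substitution lemma and soundness -/

namespace Model

variable {σ : Signature.{uS, uM, uV}} {R : ContextStructure σ.V}
  {C : DeltaMulticategory.{w, w'} (σ.delta R)}

/-- The interpretation of a term in which the occurrences of variables are not identified. -/
def lin (m : Model σ C) : ∀ {s : σ.S} (t : Term σ s), C.Hom (m.word t.tau) (m.obj s)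
  | _, .var x => C.id (m.obj (σ.vty x))
  | _, .app f t => C.comp (b := fun i => m.obj ((σ.dom f).get i))
      (a := fun i => m.word (t i).tau) (m.op f) (fun i => m.lin (t i))

/-- Lets `canon` be computed along any function that matches letters, in particular along composites
with coproducts and similarities. -/
lemma canon_eq_reindex (m : Model σ C) {v w : Word σ.V} (h : R.rel v w) {b : C.Obj}
    (g : C.Hom (m.word w) b) {θ : Fin w.len → Fin v.len} (hθ : ∀ i, v.get (θ i) = w.get i)
    (hθ' : (σ.delta R).mem θ)
    (e : m.word w = ⟨(m.word w).len, fun i => (m.word v).get (θ i)⟩) :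
    m.canon h g = C.reindex (a := m.word v) (a' := m.word w) θ hθ' e g := by
  obtain rfl := R.eq_fn_of_get h hθ
  rfl

lemma canon_congr (m : Model σ C) {v w w' : Word σ.V} (h : R.rel v w) (h' : R.rel v w') {b : C.Obj}
    {g : C.Hom (m.word w) b} {g' : C.Hom (m.word w') b} (e : w = w') (hg : HEq g g') :
    m.canon h g = m.canon h' g' := by
  subst e
  rw [eq_of_heq hg]

/-- `comp_act` pulls the inner reindexings out as a coproduct and `act_comp` merges it with the
outer one. The merged function matches letters, hence is the canonical one. -/
lemma canon_comp_canon (m : Model σ C) {n : ℕ} {v : Word σ.V} {w u : Fin n → Word σ.V}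
    (h : R.rel v (Word.concat w)) (hw : ∀ i, R.rel (w i) (u i)) (h' : R.rel v (Word.concat u))
    {b : Fin n → C.Obj} {c : C.Obj} (g : C.Hom ⟨n, b⟩ c) (f : ∀ i, C.Hom (m.word (u i)) (b i)) :
    m.canon h (C.comp (a := fun i => m.word (w i)) g (fun i => m.canon (hw i) (f i))) =
      m.canon h' (C.comp (a := fun i => m.word (u i)) g f) := by
  have hc : ∀ x, (Word.concat w).get (finCoprod (fun i => R.fn (hw i)) x) =
      (Word.concat u).get x := by
    intro x
    rw [finCoprod, Word.concat_get]
    exact R.get_fn (hw _) _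
  have e : m.word (Word.concat u) = ⟨(m.word (Word.concat u)).len, fun x =>
      (m.word (Word.concat w)).get (finCoprod (fun i => R.fn (hw i)) x)⟩ :=
    congrArg (Word.mk _) (funext fun x => congrArg (fun y => m.obj (σ.vty y)) (hc x).symm)
  have hθ : ∀ x, v.get ((R.fn h ∘ finCoprod (fun i => R.fn (hw i))) x) =
      (Word.concat u).get x := fun x => (R.get_fn h _).trans (hc x)
  have e' : m.word (Word.concat u) = ⟨(m.word (Word.concat u)).len, fun x =>
      (m.word v).get ((R.fn h ∘ finCoprod (fun i => R.fn (hw i))) x)⟩ :=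
    congrArg (Word.mk _) (funext fun x => congrArg (fun y => m.obj (σ.vty y)) (hθ x).symm)
  have h1 := C.comp_reindex (a := fun i => m.word (w i)) (u := fun i => m.word (u i))
    (σ := fun i => R.fn (hw i)) (fun i => R.fn_mem (hw i))
    (fun i => R.map_eq_fn (hw i) _) e g f
  refine (congrArg (m.canon h) h1).trans (Eq.trans ?_ (m.canon_eq_reindex h' _ hθ
    ((σ.delta R).comp_mem ((σ.delta R).coprod_mem fun i => R.fn_mem (hw i)) (R.fn_mem h)) e').symm)
  exact C.reindex_reindex (a := m.word v) (a' := m.word (Word.concat w))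
    (a'' := m.word (Word.concat u)) _ _ (R.map_eq_fn h _) e e' _

/-- The analogue for reindexing on the left of a composition, with `act_comp'` and a similarity. The
arguments `p` and `F` are indexed by variables, not positions, so that selecting them along the
reindexing requires no transport. -/
lemma canon_comp_canon_left (m : Model σ C) {v u w : Word σ.V} (h : R.rel v u) {c : C.Obj}
    (g : C.Hom (m.word u) c) (p : σ.V → Word σ.V)
    (F : ∀ x, C.Hom (m.word (p x)) (m.obj (σ.vty x)))
    (hv : R.rel w (Word.concat fun i => p (v.get i)))
    (hu : R.rel w (Word.concat fun i => p (u.get i))) :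
    m.canon hv (C.comp (b := (m.word v).get) (a := fun i => m.word (p (v.get i))) (m.canon h g)
        (fun i => F (v.get i))) =
      m.canon hu (C.comp (b := (m.word u).get) (a := fun i => m.word (p (u.get i))) g
        (fun i => F (u.get i))) := by
  have hθ := R.get_fn h
  have hm : (σ.delta R).mem (R.fn h) := R.fn_mem h
  have hcan := m.canon_eq_reindex h g hθ hm (R.map_eq_fn h _)
  generalize_proofs e₀ at hcan
  rw [hcan]
  clear hcan
  -- With an arbitrary function in place of the canonical one, the letters of `u` can be replaced by
  -- those of `v` composed with `θ`, which is the shape `act_comp'` demands.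
  generalize R.fn h = θ at hθ hm e₀
  obtain ⟨k, x⟩ := u
  change Fin k → Fin v.len at θ
  obtain rfl : x = fun i => v.get (θ i) := funext fun i => (hθ i).symm
  have h1 := C.act_comp' hm (b := (m.word v).get) (a := fun i => m.word (p (v.get i))) g
    (fun i => F (v.get i))
  have hc : ∀ x, (Word.concat fun i => p (v.get i)).get
      (finSimilarity θ (fun i => (p (v.get i)).len) x) =
      (Word.concat fun i => p (v.get (θ i))).get x := by
    intro x
    rw [finSimilarity, Word.concat_get]
    rfl
  have hθ' : ∀ x, w.get ((R.fn hv ∘ finSimilarity θ (fun i => (p (v.get i)).len)) x) =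
      (Word.concat fun i => p (v.get (θ i))).get x := fun x => (R.get_fn hv _).trans (hc x)
  have e : m.word (Word.concat fun i => p (v.get (θ i))) = ⟨_, fun x =>
      (m.word (Word.concat fun i => p (v.get i))).get
        (finSimilarity θ (fun i => (p (v.get i)).len) x)⟩ :=
    congrArg (Word.mk _) (funext fun x => congrArg (fun y => m.obj (σ.vty y)) (hc x).symm)
  have e' : m.word (Word.concat fun i => p (v.get (θ i))) = ⟨_, fun x => (m.word w).get
      ((R.fn hv ∘ finSimilarity θ (fun i => (p (v.get i)).len)) x)⟩ :=
    congrArg (Word.mk _) (funext fun x => congrArg (fun y => m.obj (σ.vty y)) (hθ' x).symm)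
  refine (congrArg (m.canon hv) h1).trans (Eq.trans ?_ (m.canon_eq_reindex hu _ hθ'
    ((σ.delta R).comp_mem ((σ.delta R).similarity_mem _ hm) (R.fn_mem hv)) e').symm)
  exact C.reindex_reindex (a := m.word w) (a' := m.word (Word.concat fun i => p (v.get i)))
    (a'' := m.word (Word.concat fun i => p (v.get (θ i)))) _ ((σ.delta R).similarity_mem _ hm)
    (R.map_eq_fn hv _) e e' _

/-- The interpretation of a term does not depend on the contexts of subterms. -/
lemma interp_eq_canon_lin (m : Model σ C) (hR : R.Modelable) {s : σ.S} (t : Term σ s)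
    {v : Word σ.V} (h : R.rel v t.tau) : m.interp hR t h = m.canon h (m.lin t) := by
  induction t generalizing v with
  | var x => rfl
  | app f t ih =>
    -- The reindexings into the chosen contexts and the outer one collapse into a single one, which
    -- no longer sees the choice.
    refine Eq.trans ?_ (m.canon_comp_canon (hR.choice.rel_concat (v := fun i => (t i).tau) h)
      (hR.choice.rel_ctx (v := fun i => (t i).tau) h) h (b := fun i => m.obj ((σ.dom f).get i))
      (m.op f) (fun i => m.lin (t i)))
    exact congrArg (fun x => m.canon (w := Word.concat _) _ (C.comp (n := (σ.dom f).len)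
      (a := fun i => m.word (hR.choice.ctx (v := fun i => (t i).tau) h i)) (m.op f) x))
      (funext fun i => ih i _)

/-- The unit law handles variables and associativity handles symbols. The equality is heterogeneous
because the domains agree only through `Term.tau_subst`. -/
lemma lin_subst (m : Model σ C) (r : ∀ x : σ.V, Term σ (σ.vty x)) {s : σ.S} (t : Term σ s) :
    HEq (m.lin (t.subst r)) (C.comp (b := (m.word t.tau).get)
      (a := fun i => m.word (r (t.tau.get i)).tau) (m.lin t) (fun i => m.lin (r (t.tau.get i)))) := by
  induction t with
  | var x =>
    refine HEq.trans (heq_of_eq (C.id_comp (m.lin (r x))).symm) ?_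
    exact castDom_heq _ _
  | app f t ih =>
    have h1 := C.comp_heq (b := fun i => m.obj ((σ.dom f).get i)) (m.op f)
      (fun i => congrArg m.word (Term.tau_subst r (t i))) ih
    refine h1.trans (HEq.trans (heq_of_eq (C.assoc (b := fun i => (m.word (t i).tau).get)
      (a := fun i j => m.word (r ((t i).tau.get j)).tau) (m.op f) (fun i => m.lin (t i))
      (fun i j => m.lin (r ((t i).tau.get j)))).symm) ?_)
    exact castDom_heq _ _

/-- In linear form, `canon_comp_canon` absorbs the reindexings of the substituted terms,
`canon_comp_canon_left` absorbs that of `t`, and `lin_subst` identifies what is left. -/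
lemma interp_subst (m : Model σ C) (hR : R.Modelable) {s : σ.S} (t : Term σ s) {v w : Word σ.V}
    {w' : Fin v.len → Word σ.V} (r : ∀ x : σ.V, Term σ (σ.vty x)) (h : R.rel v t.tau)
    (hw : R.rel w (Word.concat w')) (hr : ∀ i, R.rel (w' i) (r (v.get i)).tau)
    (h' : R.rel w (t.subst r).tau) :
    m.interp hR (t.subst r) h' = m.canon hw (C.comp (b := (m.word v).get)
      (a := fun i => m.word (w' i)) (m.interp hR t h)
        (fun i => m.interp hR (r (v.get i)) (hr i))) := by
  have hv := R.trans hw hr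
  have hu := R.subst (fun x => (r x).tau) h hv
  simp only [interp_eq_canon_lin]
  refine Eq.trans ?_ (m.canon_comp_canon hw hr hv (b := (m.word v).get) (m.canon h (m.lin t))
    (fun i => m.lin (r (v.get i)))).symm
  refine Eq.trans ?_ (m.canon_comp_canon_left h (m.lin t) (fun x => (r x).tau)
    (fun x => m.lin (r x)) hv hu).symm
  exact m.canon_congr h' hu (Term.tau_subst r t) (m.lin_subst r t)

/-- Soundness. Only the substitution rule has content: by `interp_subst` both sides are the same
composite of interpretations that agree by induction. -/
lemma interp_eq_of_derives (m : Model σ C) (hR : R.Modelable) {E : Set (REquation σ R)}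
    (hE : m.SatisfiesTheory hR E) {v : Word σ.V} {s : σ.S} {t t' : Term σ s}
    (h : Derives E v t t') (h₁ : R.rel v t.tau) (h₂ : R.rel v t'.tau) :
    m.interp hR t h₁ = m.interp hR t' h₂ := by
  induction h with
  | ax e he => exact hE e he
  | refl t _ => rfl
  | symm _ ih => exact (ih h₂ h₁).symm
  | trans h _ ih₁ ih₂ => exact (ih₁ h₁ h.rel.2).trans (ih₂ h.rel.2 h₂)
  | subst r₁ r₂ w w' ht hw hr₁ hr₂ _ ih ih' =>
    rw [m.interp_subst hR _ r₁ ht.rel.1 hw hr₁, m.interp_subst hR _ r₂ ht.rel.2 hw hr₂,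
      ih ht.rel.1 ht.rel.2]
    exact congrArg (fun x => m.canon hw (C.comp (b := (m.word _).get)
      (a := fun i => m.word (w' i)) (m.interp hR _ ht.rel.2) x)) (funext fun i => ih' i (hr₁ i) (hr₂ i))

end Model

/-! ### Morphisms of multicategories and morphisms of set models -/

namespace Model

variable {σ : Signature.{uS, uM, uV}} {R : ContextStructure σ.V}
  {C : DeltaMulticategory.{u, v} (σ.delta R)} {D : DeltaMulticategory.{w, w'} (σ.delta R)}

lemma map_castDom (T : C.Functor D) {a a' : Word C.Obj} {b : C.Obj} (e : a = a') (g : C.Hom a b) :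
    T.map (castDom e g) = castDom (congrArg (Word.map T.obj) e) (T.map g) := by
  subst e; rfl

lemma map_canon (m : Model σ C) (T : C.Functor D) {v w : Word σ.V} (h : R.rel v w) {b : C.Obj}
    (g : C.Hom (m.word w) b) : T.map (m.canon h g) = (m.map T).canon h (T.map g) :=
  (T.map_act _ _ _ _ _).trans (congrArg (D.act (R.fn h) (R.fn_mem h) _ _) (map_castDom T _ _))

lemma map_lin (m : Model σ C) (T : C.Functor D) {s : σ.S} (t : Term σ s) :
    T.map (m.lin t) = (m.map T).lin t := by
  induction t with
  | var x => exact T.map_id _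
  | app f t ih =>
    refine (T.map_comp (b := fun i => m.obj ((σ.dom f).get i)) (a := fun i => m.word (t i).tau)
      (m.op f) (fun i => m.lin (t i))).trans ?_
    exact congrArg (D.comp (b := fun i => (m.map T).obj ((σ.dom f).get i))
      (a := fun i => (m.map T).word (t i).tau) ((m.map T).op f)) (funext ih)

/-- In linear form it is enough that the functor commutes with composition, identities and one
action. -/
lemma map_interp (m : Model σ C) (T : C.Functor D) (hR : R.Modelable) {s : σ.S} (t : Term σ s)
    {v : Word σ.V} (h : R.rel v t.tau) :
    T.map (m.interp hR t h) = (m.map T).interp hR t h := by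
  rw [interp_eq_canon_lin, interp_eq_canon_lin, map_canon, map_lin]
  rfl

end Model

namespace SetModel

section

variable {σ : Signature.{uS, uM, uV}} {Δ : StructureCategory} {D : DeltaMulticategory.{w, w'} Δ}

/-- The model of the extended signature consisting of the multimorphisms between the objects of a
`σ`-model. -/
def ofModel (n : Model σ D) : SetModel.{w'} (σ.ext Δ) where
  carrier p := D.Hom (p.1.map n.obj) (n.obj p.2)
  op
    | .comp (n := k) b a _, x => D.comp (b := fun i => n.obj (b i))
        (a := fun i => (a i).map n.obj) (x (0 : Fin (k + 1))) (fun i => x (i.succ : Fin (k + 1)))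
    | .id c, _ => D.id (n.obj c)
    | .act θ hθ b c, x => D.act θ hθ (fun i => n.obj (b i)) (n.obj c) (x (0 : Fin 1))
    | .op f, _ => n.op f

/-- In contrast to `eval_cast`, the transport is along an equality of words of objects of `D`, the
form in which the axioms of `D` are stated. -/
lemma ofModel_eval_cast (n : Model σ D) {U : Set (σ.ext Δ).V}
    (ρ : ∀ x ∈ U, (ofModel n).carrier ((σ.ext Δ).vty x)) {a a' : Word σ.S} {c : σ.S} (e : a = a')
    (h : ExtTerm σ Δ a c) (H : VarsIn U (castDom e h)) :
    (ofModel n).evalT ρ (castDom e h) H = castDom (H := D.Hom) (congrArg (Word.map n.obj) e)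
      ((ofModel n).evalT ρ h (by subst e; exact H)) := by
  subst e; rfl

/-- Each equation evaluates to the corresponding axiom of `D`; the work lies in moving the
transports out of the evaluation. -/
lemma ofModel_categorization (n : Model σ D) :
    (ofModel n).SatisfiesTheory {e | Categorization σ Δ e} := by
  rintro _ (⟨c, d, b, a⟩ | ⟨a, d⟩ | ⟨c, d⟩ | ⟨c, d⟩ | ⟨hθ, hφ, c, d⟩ | 
    @⟨_, _, θ, hθ, c, d, a⟩ | @⟨_, k, b, c, a, τ, hτ⟩) ρ
  · refine (ofModel_eval_cast n ρ (Word.concat_concat a) _ _).trans ?_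
    let el i := (ofModel n).evalT ρ (extVar (enum₃ _) (assocSort c d b a) i) (VarsIn.var _ _ i)
    exact D.assoc (c := fun i => n.obj (c i)) (b := fun i j => n.obj (b i j))
      (a := fun i j => (a i j).map n.obj) (el (.inl 0)) (fun i => el (.inr (.inl i)))
      (fun i j => el (.inr (.inr ⟨i, j⟩)))
  · refine (ofModel_eval_cast n ρ (Word.concat_one a) _ _).trans ?_
    exact D.id_comp ((ofModel n).evalT ρ (extVar (Equiv.refl (Fin 1)) (fun _ => (a, d)) 0)
      (VarsIn.var _ _ 0))
  · refine (ofModel_eval_cast n ρ (Word.concat_single c) _ _).trans ?_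
    exact D.comp_id _
  · exact D.act_id _
  · exact D.act_comp hθ hφ (a := fun i => n.obj (c i)) _
  · refine Eq.symm (((ofModel n).eval_act ρ _ _).trans ((congrArg ((ofModel n).actOp _
      (Δ.similarity_mem _ hθ) (Word.concat a).get d)
        (ofModel_eval_cast n ρ (Word.concat_similarity _ a) _ _)).trans ?_))
    let el i := (ofModel n).evalT ρ (extVar (enum₂ _) (actLeftSort θ c d a) i) (VarsIn.var _ _ i)
    exact (D.act_comp' hθ (b := fun i => n.obj (c i)) (a := fun i => (a i).map n.obj)
      (el (.inl 0)) (fun i => el (.inr i))).symm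
  · refine Eq.symm (((ofModel n).eval_act ρ _ _).trans ((congrArg ((ofModel n).actOp _
      (Δ.coprod_mem hτ) (Word.concat a).get c)
        (ofModel_eval_cast n ρ (Word.concat_coprod a _) _ _)).trans ?_))
    let el i := (ofModel n).evalT ρ (extVar (enum₂ _) (actRightSort k b c a τ) i) (VarsIn.var _ _ i)
    exact (D.comp_act hτ (b := fun i => n.obj (b i)) (a := fun i => (a i).map n.obj)
      (el (.inl 0)) (fun i => el (.inr i))).symm

variable {A : SetModel.{v} (σ.ext Δ)} {hA : A.SatisfiesTheory {e | Categorization σ Δ e}}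

/-- The morphism of multicategories given by a morphism of models in sets. -/
noncomputable def Hom.toFunctor {n : Model σ D} (φ : A.Hom (ofModel n)) :
    (A.toMulticategory hA).Functor D where
  obj := n.obj
  map {a b} := φ.map (a, b)
  map_comp {_ b a c} _ _ := φ.map_op (ExtSymbol.comp b a c) _
  map_id c := φ.map_op (ExtSymbol.id c) _
  map_act θ hθ a b _ := φ.map_op (ExtSymbol.act θ hθ a b) _

/-- The morphism of models in sets given by a morphism of multicategories. -/
noncomputable def homOfFunctor (T : (A.toMulticategory hA).Functor D) :
    A.Hom (ofModel ((A.toModel hA).map T)) where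
  map _ x := T.map x
  map_op f x := by
    cases f with
    | comp b a c =>
      refine Eq.trans ?_ (T.map_comp (C := A.toMulticategory hA) (b := b) (a := a) (c := c) _ _)
      refine congrArg (fun y => T.map (A.op (ExtSymbol.comp b a c) y)) ?_
      funext i
      refine Fin.cases ?_ (fun i => ?_) i <;> rfl
    | id c =>
      refine Eq.trans ?_ (T.map_id (C := A.toMulticategory hA) c)
      exact congrArg (fun y => T.map (A.op (ExtSymbol.id c) y)) (funext fun i => Fin.elim0 i)
    | act θ hθ b c =>
      refine Eq.trans ?_ (T.map_act (C := A.toMulticategory hA) θ hθ b c _)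
      refine congrArg (fun y => T.map (A.op (ExtSymbol.act θ hθ b c) y)) ?_
      funext i
      rw [Subsingleton.elim (α := Fin 1) i 0]
    | op f =>
      exact congrArg (fun y => T.map (A.op (ExtSymbol.op f) y)) (funext fun i => Fin.elim0 i)

lemma toModel_map_toFunctor {n : Model σ D} (φ : A.Hom (ofModel n)) :
    (A.toModel hA).map (φ.toFunctor (hA := hA)) = n := by
  refine Model.ext rfl (heq_of_eq (funext fun f => ?_))
  exact φ.map_op (ExtSymbol.op f) _

/-- `homOfFunctor` has a target depending on the functor. Both functors induce the model `n`, so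
they agree on objects and can be compared as morphisms into one set model. -/
lemma functor_eq_of_hom_eq {n : Model σ D} (hn : ∀ φ ψ : A.Hom (ofModel n), φ = ψ)
    {T T' : (A.toMulticategory hA).Functor D} (hT : (A.toModel hA).map T = n)
    (hT' : (A.toModel hA).map T' = n) : T = T' := by
  subst hT
  have hobj : T'.obj = T.obj := congrArg Model.obj hT'
  obtain ⟨o, t, _, _, _⟩ := T
  obtain ⟨o', t', h₁, h₂, h₃⟩ := T'
  obtain rfl : o' = o := hobj
  -- `t'` is repackaged as a morphism into the target belonging to `t`. The two targets could differ
  -- only in the operations given by symbols of `σ`, and these agree by `hT'`.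
  have := hn (homOfFunctor ⟨o', t, _, _, _⟩) ⟨fun _ x => t' x, by
    intro f x
    have h := (homOfFunctor (A := A) (hA := hA) ⟨o', t', h₁, h₂, h₃⟩).map_op f x
    cases f with
    | op f => exact h.trans (congrFun (eq_of_heq (Model.mk.inj hT').2) f)
    | _ => exact h⟩
  have key : @t = @t' := by
    funext a b x
    exact congrFun (congrFun (congrArg Hom.map this) (a, b)) x
  subst key
  rfl

end

/-! ### Internalized equations and initiality among multicategories -/

variable {σ : Signature.{uS, uM, uV}} {R : ContextStructure σ.V}

/-- The induction of `interp_eq_canon_lin`, with the contexts supplied by `κ`. The right side does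
not involve `κ`, so every choice of contexts internalizes a term to the same value. -/
lemma evalT_internalize (A : SetModel.{w} (σ.ext (σ.delta R)))
    (hA : A.SatisfiesTheory {e | Categorization σ (σ.delta R) e}) (κ : R.ContextChoice)
    {U : Set (σ.ext (σ.delta R)).V} (ρ : ∀ x ∈ U, A.carrier ((σ.ext (σ.delta R)).vty x))
    {s : σ.S} (t : Term σ s) {v : Word σ.V} (h : R.rel v t.tau) :
    A.evalT ρ (internalize κ t h) (varsIn_internalize κ U t h) =
      (A.toModel hA).canon h ((A.toModel hA).lin t) := by
  induction t generalizing v with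
  | var x =>
    refine (A.eval_act ρ _ _).trans (congrArg (A.actOp _ (R.fn_mem h) _ _) ?_)
    exact (A.eval_cast ρ _ _ _).trans (congrArg _ (A.eval_id ρ _ _))
  | app f t ih =>
    refine Eq.trans ?_ ((A.toModel hA).canon_comp_canon (b := (σ.dom f).get)
      (κ.rel_concat (v := fun i => (t i).tau) h)
      (κ.rel_ctx (v := fun i => (t i).tau) h) h (A.symbolOp f)
      (fun i => (A.toModel hA).lin (t i)))
    refine (A.eval_act ρ _ _).trans (congrArg (A.actOp _ (R.fn_mem _) _ _) ?_)
    refine (A.eval_cast ρ _ _ _).trans (congrArg _ ((A.eval_comp ρ _ _ _).trans ?_))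
    refine congrArg₂ (A.compOp (b := (σ.dom f).get)) ?_ (funext fun i => ih i _)
    exact congrArg (A.op (ExtSymbol.op f)) (funext fun i => Fin.elim0 i)

lemma satisfies_internalizeEq_iff (A : SetModel.{w} (σ.ext (σ.delta R)))
    (hA : A.SatisfiesTheory {e | Categorization σ (σ.delta R) e}) (κ : R.ContextChoice)
    (hR : R.Modelable) (φ : REquation σ R) :
    A.Satisfies (internalizeEq κ φ) ↔ (A.toModel hA).Satisfies hR φ := by
  have key (ρ : ∀ x ∈ Set.range (Word.nil : Word (σ.ext (σ.delta R)).V).get,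
      A.carrier ((σ.ext (σ.delta R)).vty x)) {s : σ.S} (t : Term σ s) {v : Word σ.V}
      (h : R.rel v t.tau) : A.eval ρ (internalize κ t h) (varsIn_internalize κ _ t h) =
      (A.toModel hA).interp hR t h :=
    (A.evalT_internalize hA κ ρ t h).trans (Model.interp_eq_canon_lin _ _ _ _).symm
  constructor
  · intro h
    -- The internalized equation has the empty context, so an assignment exists vacuously.
    have := h fun x hx => Fin.elim0 hx.choose
    exact (key _ _ _).symm.trans (this.trans (key _ _ _))
  · intro h ρ
    exact (key _ _ _).trans (h.trans (key _ _ _).symm)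

lemma ofModel_satisfiesTheory {D : DeltaMulticategory.{w, w'} (σ.delta R)} (n : Model σ D)
    (κ : R.ContextChoice) (hR : R.Modelable) {E : Set (REquation σ R)}
    (hn : n.SatisfiesTheory hR E) : (ofModel n).SatisfiesTheory (multicatTheory κ E) := by
  rintro _ (he | ⟨φ, hφ, rfl⟩)
  · exact ofModel_categorization n _ he
  · rw [satisfies_internalizeEq_iff _ (ofModel_categorization n) κ hR]
    -- `J` is the identity on multimorphisms and carries the tautological model to `n`, so
    -- interpretations in `ofModel n` and in `D` coincide.
    let J := (Hom.id (ofModel n)).toFunctor (hA := ofModel_categorization n)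
    have h := hn φ hφ
    exact (Model.map_interp _ J hR _ _).trans (h.trans
      (Model.map_interp ((ofModel n).toModel (ofModel_categorization n)) J hR _ _).symm)

lemma IsInitialModel.toModel_satisfiesTheory {C : SetModel.{w} (σ.ext (σ.delta R))}
    {κ : R.ContextChoice} {E : Set (REquation σ R)}
    (hC : C.IsInitialModel (multicatTheory κ E)) (hR : R.Modelable) :
    (C.toModel hC.categorization).SatisfiesTheory hR E := fun φ hφ =>
  (satisfies_internalizeEq_iff C hC.categorization κ hR φ).1
    (hC.1 _ (Or.inr (Set.mem_image_of_mem _ hφ)))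

/-- The set model `ofModel n` may lie in any universe, whence `exists_hom` instead of the bare
definition of initiality. -/
lemma IsInitialModel.existsUnique_functor {C : SetModel.{max uS uM} (σ.ext (σ.delta R))}
    {κ : R.ContextChoice} {E : Set (REquation σ R)}
    (hC : C.IsInitialModel (multicatTheory κ E)) (hR : R.Modelable)
    {D : DeltaMulticategory.{w, w'} (σ.delta R)} (n : Model σ D) (hn : n.SatisfiesTheory hR E) :
    ∃! T : (C.toMulticategory hC.categorization).Functor D,
      (C.toModel hC.categorization).map T = n := by
  obtain ⟨hu⟩ := hC.exists_hom (ofModel n) (ofModel_satisfiesTheory n κ hR hn)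
  refine ⟨hu.default.toFunctor, toModel_map_toFunctor _, fun T hT => ?_⟩
  exact functor_eq_of_hom_eq (fun φ ψ => (hu.2 φ).trans (hu.2 ψ).symm) hT
    (toModel_map_toFunctor _)

end SetModel

/-! ### The multicategory of terms modulo derivable equations -/

lemma finCoprod_apply {n : ℕ} {k l : Fin n → ℕ} (f : ∀ i, Fin (k i) → Fin (l i)) (i : Fin n)
    (x : Fin (k i)) :
    finCoprod f (finSigmaFinEquiv ⟨i, x⟩) = finSigmaFinEquiv ⟨i, f i x⟩ := by
  rw [finCoprod, Equiv.symm_apply_apply]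

lemma finSimilarity_apply {m n : ℕ} (θ : Fin m → Fin n) (k : Fin n → ℕ) (i : Fin m)
    (x : Fin (k (θ i))) :
    finSimilarity θ k (finSigmaFinEquiv ⟨i, x⟩) = finSigmaFinEquiv ⟨θ i, x⟩ := by
  rw [finSimilarity, Equiv.symm_apply_apply]

/-- When letters are their own positions, an equation of words records what `Fin.cast` does to
indices. The index laws below are the laws of concatenation read in this way. -/
lemma Word.get_eq_cast {n : ℕ} {a : Word (Fin n)} (e : a = ⟨n, id⟩) (i : Fin a.len) :
    a.get i = Fin.cast (congrArg Word.len e) i := by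
  subst e; rfl

lemma cast_finSigma_single {n : ℕ} (e : ∑ _ : Fin n, 1 = n) (i : Fin n) (j : Fin 1) :
    Fin.cast e (finSigmaFinEquiv (n := fun _ => 1) ⟨i, j⟩) = i :=
  (Word.get_eq_cast (Word.concat_single (id : Fin n → Fin n)) _).symm.trans
    (Word.concat_get (fun i => Word.single i) ⟨i, j⟩)

lemma cast_finSigma_one {n : ℕ} (e : ∑ _ : Fin 1, n = n) (i : Fin 1) (j : Fin n) :
    Fin.cast e (finSigmaFinEquiv (n := fun _ => n) ⟨i, j⟩) = j :=
  (Word.get_eq_cast (Word.concat_one ⟨n, id⟩) _).symm.trans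
    (Word.concat_get (fun _ => ⟨n, id⟩) ⟨i, j⟩)

lemma cast_finSigma_finSigma {n : ℕ} {m : Fin n → ℕ} (k : ∀ i, Fin (m i) → ℕ)
    (e : ∑ q : Fin (∑ i, m i), k (finSigmaFinEquiv.symm q).1 (finSigmaFinEquiv.symm q).2 =
      ∑ i, ∑ j, k i j) (q : Fin (∑ i, m i))
    (l : Fin (k (finSigmaFinEquiv.symm q).1 (finSigmaFinEquiv.symm q).2)) :
    Fin.cast e (finSigmaFinEquiv (n := fun q : Fin (∑ i, m i) =>
        k (finSigmaFinEquiv.symm q).1 (finSigmaFinEquiv.symm q).2) ⟨q, l⟩) =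
      finSigmaFinEquiv (n := fun i => ∑ j, k i j) ⟨(finSigmaFinEquiv.symm q).1,
        finSigmaFinEquiv (n := k _) ⟨(finSigmaFinEquiv.symm q).2, l⟩⟩ := by
  let a (i : Fin n) (j : Fin (m i)) : Word (Fin (∑ i, ∑ j, k i j)) :=
    ⟨k i j, fun l => finSigmaFinEquiv (n := fun i => ∑ j, k i j)
      ⟨i, finSigmaFinEquiv (n := k i) ⟨j, l⟩⟩⟩
  have ha : Word.concat (fun i => Word.concat (a i)) = ⟨_, id⟩ := by
    refine congrArg (Word.mk _) (funext fun x => ?_)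
    change finSigmaFinEquiv (n := fun i => ∑ j, k i j) ⟨_, finSigmaFinEquiv (n := k _)
      (finSigmaFinEquiv.symm (finSigmaFinEquiv.symm x).2)⟩ = x
    exact (congrArg (fun y => finSigmaFinEquiv (n := fun i => ∑ j, k i j) ⟨_, y⟩)
      (Equiv.apply_symm_apply finSigmaFinEquiv _)).trans (Equiv.apply_symm_apply _ x)
  exact (Word.get_eq_cast ((Word.concat_concat a).trans ha) _).symm.trans
    (Word.concat_get (fun q => a (finSigmaFinEquiv.symm q).1 (finSigmaFinEquiv.symm q).2) ⟨q, l⟩)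

/-- There are contexts of arbitrary words of sorts. -/
lemma Signature.exists_context (σ : Signature.{uS, uM, uV}) {n : ℕ} (s : Fin n → σ.S) :
    ∃ v : Fin n → σ.V, Function.Injective v ∧ ∀ i, σ.vty (v i) = s i := by
  have := σ.infinite_fiber
  let e (s : σ.S) : ℕ ↪ {x : σ.V // σ.vty x = s} := Infinite.natEmbedding _
  -- The `i`-th letter is the variable numbered `i` of its sort, so letters stay distinct even when
  -- sorts repeat.
  refine ⟨fun i => (e (s i) i).1, fun i j hij => ?_, fun i => (e (s i) i).2⟩
  have key : ∀ (s s' : σ.S) (k l : ℕ), (e s k).1 = (e s' l).1 → k = l := by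
    intro s s' k l h
    obtain rfl : s = s' := (e s k).2.symm.trans ((congrArg σ.vty h).trans (e s' l).2)
    exact (e s).injective (Subtype.ext h)
  exact Fin.ext (key _ _ _ _ hij)

/-- A substitution with prescribed values on a context. -/
lemma Term.exists_subst {σ : Signature.{uS, uM, uV}} {n : ℕ} {v : Fin n → σ.V}
    (hv : Function.Injective v) (t : ∀ i, Term σ (σ.vty (v i))) :
    ∃ r : ∀ x : σ.V, Term σ (σ.vty x), ∀ i, r (v i) = t i := by
  classical
  -- Variables outside the context are left alone; injectivity makes the chosen preimage the
  -- expected one.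
  refine ⟨fun x => if h : ∃ i, v i = x then h.choose_spec ▸ t h.choose else .var x, fun i => ?_⟩
  have h : ∃ j, v j = v i := ⟨i, rfl⟩
  have key : ∀ (j : Fin n) (hj : v j = v i), (hj ▸ t j : Term σ (σ.vty (v i))) = t i := by
    intro j hj
    obtain rfl := hv hj
    rfl
  exact (dif_pos h).trans (key _ h.choose_spec)

/-! ### Derived rules: weakening and congruence -/

section Weakening

variable {σ : Signature.{uS, uM, uV}} {R : ContextStructure σ.V} {E : Set (REquation σ R)}

/-- The identity substitution, with each variable in its own one-letter context, is an instance of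
the substitution rule. -/
lemma Derives.weaken {v w : Word σ.V} {s : σ.S} {t t' : Term σ s} (h : Derives E v t t')
    (hw : R.rel w v) : Derives E w t t' := by
  have hs (i : Fin v.len) : R.rel (Word.single (v.get i)) (Word.single (v.get i)) :=
    R.refl fun _ _ _ => Subsingleton.elim (α := Fin 1) _ _
  have := Derives.subst (E := E) Term.var Term.var w (fun i => Word.single (v.get i)) h
    (by rw [Word.concat_single]; exact hw) hs hs (fun i => .refl _ (hs i))
  rwa [Term.subst_var, Term.subst_var] at this

/-- Congruence is not a primitive rule. It comes from substituting into the reflexivity of `f`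
applied to distinct variables. -/
lemma Derives.app (f : σ.M) {w : Word σ.V} {w' : Fin (σ.dom f).len → Word σ.V}
    {t t' : ∀ i, Term σ ((σ.dom f).get i)} (hw : R.rel w (Word.concat w'))
    (h : ∀ i, Derives E (w' i) (t i) (t' i)) : Derives E w (.app f t) (.app f t') := by
  obtain ⟨v, hv, hs⟩ := σ.exists_context (σ.dom f).get
  have hcast {x : σ.V} {s : σ.S} (e : σ.vty x = s) (r : ∀ x : σ.V, Term σ (σ.vty x)) :
      (e ▸ Term.var x : Term σ s).tau = Word.single x ∧
        (e ▸ Term.var x : Term σ s).subst r = e ▸ r x := by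
    subst e; exact ⟨rfl, rfl⟩
  obtain ⟨r, hr⟩ := Term.exists_subst hv fun i => ((hs i).symm ▸ t i : Term σ (σ.vty (v i)))
  obtain ⟨r', hr'⟩ := Term.exists_subst hv fun i => ((hs i).symm ▸ t' i : Term σ (σ.vty (v i)))
  let q : Term σ (σ.cod f) := .app f fun i => hs i ▸ .var (v i)
  have hq : q.tau = ⟨_, v⟩ := by
    refine Eq.trans ?_ (Word.concat_single v)
    exact congrArg Word.concat (funext fun i => (hcast (hs i) r).1)
  have hsub (r : ∀ x : σ.V, Term σ (σ.vty x)) (t : ∀ i, Term σ ((σ.dom f).get i))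
      (hr : ∀ i, r (v i) = (hs i).symm ▸ t i) : q.subst r = .app f t := by
    refine congrArg (Term.app f) (funext fun i => (hcast (hs i) r).2.trans ?_)
    rw [hr]
    have key {s s' : σ.S} (e : s = s') (q : Term σ s') : e ▸ (e.symm ▸ q : Term σ s) = q := by
      subst e; rfl
    exact key _ _
  have hD (i) : Derives E (w' i) (r (v i)) (r' (v i)) := by
    rw [hr, hr']
    generalize hs i = e
    generalize σ.vty (v i) = s at e
    subst e
    exact h i
  have := Derives.subst (E := E) (v := ⟨_, v⟩) r r' w w'
    (.refl q (by rw [hq]; exact R.refl hv)) hw (fun i => (hD i).rel.1) (fun i => (hD i).rel.2) hD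
  rwa [hsub r t hr, hsub r' t' hr'] at this

/-- The sort `s` only ensures that there are variables at all: membership in `Δ_R` quantifies over
contexts of length `n` and would be vacuous without one. -/
lemma ContextStructure.rel_concat_comp (s : σ.S) {m n : ℕ} {θ : Fin m → Fin n}
    (hθ : R.deltaMem θ) {w : Word σ.V} {w' : Fin n → Word σ.V} (hw : R.rel w (Word.concat w')) :
    R.rel w (Word.concat fun i => w' (θ i)) := by
  obtain ⟨d, hd, -⟩ := σ.exists_context fun _ : Fin n => s
  exact R.rel_rename hd (hθ d hd) w' hw

end Weakening

/-! ### Operations on terms modulo a logical relation -/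

namespace TermMulticategory

variable {σ : Signature.{uS, uM, uV}} {R : ContextStructure σ.V}

/-- Terms of arbitrary sort. -/
abbrev AnyTerm (σ : Signature.{uS, uM, uV}) : Type (max uS uM uV) := (s : σ.S) × Term σ s

/-- Both terms are of sort `s`, and they are derivably equal in the context `w`. -/
def Related (E : Set (REquation σ R)) (w : Word σ.V) (s : σ.S) (p q : AnyTerm σ) : Prop :=
  ∃ t t' : Term σ s, p = ⟨s, t⟩ ∧ q = ⟨s, t'⟩ ∧ Derives E w t t'

variable {E : Set (REquation σ R)}

lemma Related.symm {w : Word σ.V} {s : σ.S} {p q : AnyTerm σ} (h : Related E w s p q) :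
    Related E w s q p := by
  obtain ⟨t, t', rfl, rfl, h⟩ := h
  exact ⟨t', t, rfl, rfl, h.symm⟩

lemma Related.trans {w : Word σ.V} {s : σ.S} {p q r : AnyTerm σ} (h : Related E w s p q)
    (h' : Related E w s q r) : Related E w s p r := by
  obtain ⟨t, t', rfl, rfl, h⟩ := h
  obtain ⟨t₁, t₂, h₁, rfl, h'⟩ := h'
  obtain rfl := eq_of_heq (Sigma.mk.inj h₁).2
  exact ⟨t, t₂, rfl, rfl, h.trans h'⟩

variable (E) in
/-- The partial equivalence relation on operations on terms: related arguments have related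
values. -/
def HomRel (a : Word σ.S) (b : σ.S) (F G : (Fin a.len → AnyTerm σ) → AnyTerm σ) : Prop :=
  -- Each argument has its own context and values are compared in every context of the
  -- concatenation, exactly as in the substitution rule.
  ∀ (w : Word σ.V) (w' : Fin a.len → Word σ.V) (x y : Fin a.len → AnyTerm σ),
    R.rel w (Word.concat w') → (∀ i, Related E (w' i) (a.get i) (x i) (y i)) →
      Related E w b (F x) (G y)

section

variable {a : Word σ.S} {b : σ.S} {F G H : (Fin a.len → AnyTerm σ) → AnyTerm σ}

lemma HomRel.symm (h : HomRel E a b F G) : HomRel E a b G F := fun w w' x y hw hxy =>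
  (h w w' y x hw fun i => (hxy i).symm).symm

/-- The relation on arguments is only partial, but `x` is related to itself as soon as it is related
to some `y`; this supplies the intermediate value. -/
lemma HomRel.trans (h : HomRel E a b F G) (h' : HomRel E a b G H) : HomRel E a b F H :=
  fun w w' x y hw hxy =>
    (h w w' x x hw fun i => (hxy i).trans (hxy i).symm).trans (h' w w' x y hw hxy)

end

variable (E) in
/-- The equivalence relation on the operations related to themselves. -/
def homSetoid (a : Word σ.S) (b : σ.S) :
    Setoid {F : (Fin a.len → AnyTerm σ) → AnyTerm σ // HomRel E a b F F} :=
  ⟨fun F G => HomRel E a b F.1 G.1, fun F => F.2, HomRel.symm, HomRel.trans⟩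

variable (E) in
/-- Multimorphisms of the multicategory of terms. -/
def THom (a : Word σ.S) (b : σ.S) : Type (max uS uM uV) := Quotient (homSetoid E a b)

/-- The class of an operation. -/
def mk {a : Word σ.S} {b : σ.S} (F : (Fin a.len → AnyTerm σ) → AnyTerm σ)
    (hF : HomRel E a b F F) : THom E a b := Quotient.mk (homSetoid E a b) ⟨F, hF⟩

lemma mk_eq_mk {a : Word σ.S} {b : σ.S} {F G : (Fin a.len → AnyTerm σ) → AnyTerm σ}
    {hF : HomRel E a b F F} {hG : HomRel E a b G G} : mk F hF = mk G hG ↔ HomRel E a b F G :=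
  ⟨fun h => Quotient.exact (s := homSetoid E a b) h,
    fun h => Quotient.sound (s := homSetoid E a b) h⟩

lemma mk_congr {a : Word σ.S} {b : σ.S} {F G : (Fin a.len → AnyTerm σ) → AnyTerm σ}
    {hF : HomRel E a b F F} {hG : HomRel E a b G G} (h : F = G) : mk F hF = mk G hG := by
  subst h; rfl

/-- A representative of a multimorphism. -/
noncomputable def rep {a : Word σ.S} {b : σ.S} (f : THom E a b) :
    (Fin a.len → AnyTerm σ) → AnyTerm σ := (Quotient.out (s := homSetoid E a b) f).1

lemma rep_rel {a : Word σ.S} {b : σ.S} (f : THom E a b) : HomRel E a b (rep f) (rep f) :=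
  (Quotient.out (s := homSetoid E a b) f).2

lemma mk_rep {a : Word σ.S} {b : σ.S} (f : THom E a b) : mk (rep f) (rep_rel f) = f :=
  Quotient.out_eq (s := homSetoid E a b) f

lemma rep_mk {a : Word σ.S} {b : σ.S} {F : (Fin a.len → AnyTerm σ) → AnyTerm σ}
    (hF : HomRel E a b F F) : HomRel E a b (rep (mk F hF)) F :=
  mk_eq_mk.1 (mk_rep (mk F hF))

lemma homRel_cast {a a' : Word σ.S} {b : σ.S} (e : a = a')
    {F G : (Fin a.len → AnyTerm σ) → AnyTerm σ} (h : HomRel E a b F G) :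
    HomRel E a' b (fun x => F fun i => x (Fin.cast (congrArg Word.len e) i))
      (fun x => G fun i => x (Fin.cast (congrArg Word.len e) i)) := by
  subst e; exact h

/-- Operations take terms of arbitrary sort, so their type depends only on the length of the word
and a transport merely renumbers arguments. -/
lemma castDom_mk {a a' : Word σ.S} {b : σ.S} (e : a = a')
    {F : (Fin a.len → AnyTerm σ) → AnyTerm σ} (hF : HomRel E a b F F) :
    castDom (H := THom E) e (mk F hF) =
      mk (fun x => F fun i => x (Fin.cast (congrArg Word.len e) i)) (homRel_cast e hF) := by
  subst e; rfl

/-- Modelability enters here: grouping the argument contexts into blocks, it yields a context for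
each block in which the inner values can be compared, and the outer operation is applied over these.
-/
lemma homRel_comp (hR : R.Modelable) {n : ℕ} {b : Fin n → σ.S} {a : Fin n → Word σ.S} {c : σ.S}
    {G G' : (Fin n → AnyTerm σ) → AnyTerm σ} {F F' : ∀ i, (Fin (a i).len → AnyTerm σ) → AnyTerm σ}
    (hG : HomRel E ⟨n, b⟩ c G G') (hF : ∀ i, HomRel E (a i) (b i) (F i) (F' i)) :
    HomRel E (Word.concat a) c (fun x => G fun i => F i fun j => x (finSigmaFinEquiv ⟨i, j⟩))
      (fun x => G' fun i => F' i fun j => x (finSigmaFinEquiv ⟨i, j⟩)) := by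
  intro w w' x y hw hxy
  have hc : Word.concat w' =
      Word.concat fun i => Word.concat fun j : Fin (a i).len => w' (finSigmaFinEquiv ⟨i, j⟩) := by
    refine Eq.trans ?_ (Word.concat_concat
      (fun i (j : Fin (a i).len) => w' (finSigmaFinEquiv ⟨i, j⟩)))
    exact congrArg Word.concat (funext fun k => congrArg w' (Equiv.apply_symm_apply _ k).symm)
  obtain ⟨u, hu, hu'⟩ := hR (hc ▸ hw)
  refine hG w u _ _ hu fun i => hF i (u i) _ _ _ (hu' i) fun j => ?_
  have h := hxy (finSigmaFinEquiv ⟨i, j⟩)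
  rwa [Word.concat_get] at h

/-- Composition. -/
noncomputable def comp (hR : R.Modelable) {n : ℕ} {b : Fin n → σ.S} {a : Fin n → Word σ.S}
    {c : σ.S} (g : THom E ⟨n, b⟩ c) (f : ∀ i, THom E (a i) (b i)) : THom E (Word.concat a) c :=
  mk _ (homRel_comp hR (rep_rel g) (fun i => rep_rel (f i)))

/-- Composition is defined on chosen representatives but may be computed on any. The multicategory
axioms thereby become equalities of functions up to renumbering of arguments. -/
lemma comp_mk (hR : R.Modelable) {n : ℕ} {b : Fin n → σ.S} {a : Fin n → Word σ.S} {c : σ.S}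
    {G : (Fin n → AnyTerm σ) → AnyTerm σ} {F : ∀ i, (Fin (a i).len → AnyTerm σ) → AnyTerm σ}
    (hG : HomRel E ⟨n, b⟩ c G G) (hF : ∀ i, HomRel E (a i) (b i) (F i) (F i)) :
    comp hR (mk (a := ⟨n, b⟩) G hG) (fun i => mk (F i) (hF i)) = mk _ (homRel_comp hR hG hF) :=
  mk_eq_mk.2 (homRel_comp hR (rep_mk (a := ⟨n, b⟩) hG) fun i => rep_mk (hF i))

lemma homRel_id (c : σ.S) :
    HomRel E (Word.single c) c (fun x => x (0 : Fin 1)) (fun x => x (0 : Fin 1)) := by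
  intro w w' x y hw hxy
  obtain ⟨t, t', hx, hy, h⟩ := hxy (0 : Fin 1)
  refine ⟨t, t', hx, hy, h.weaken ?_⟩
  have hw' : w' = fun _ : Fin 1 => w' (0 : Fin 1) :=
    funext fun i => congrArg w' (Subsingleton.elim (α := Fin 1) _ _)
  rw [hw'] at hw
  rwa [← Word.concat_one (w' (0 : Fin 1))]

lemma homRel_act {m n : ℕ} {θ : Fin m → Fin n} (hθ : R.deltaMem θ) {a : Fin n → σ.S} {b : σ.S}
    {F G : (Fin m → AnyTerm σ) → AnyTerm σ} (h : HomRel E ⟨m, fun i => a (θ i)⟩ b F G) :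
    HomRel E ⟨n, a⟩ b (fun x => F fun i => x (θ i)) (fun x => G fun i => x (θ i)) :=
  fun w w' _ _ hw hxy => h w (fun i => w' (θ i)) _ _ (R.rel_concat_comp b hθ hw)
    fun i => hxy (θ i)

/-- The action of `Δ_R`. -/
noncomputable def act {m n : ℕ} (θ : Fin m → Fin n) (hθ : R.deltaMem θ) (a : Fin n → σ.S) (b : σ.S)
    (f : THom E ⟨m, fun i => a (θ i)⟩ b) : THom E ⟨n, a⟩ b :=
  mk (a := ⟨n, a⟩) _ (homRel_act hθ (rep_rel f))

lemma act_mk {m n : ℕ} {θ : Fin m → Fin n} (hθ : R.deltaMem θ) {a : Fin n → σ.S} {b : σ.S}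
    {F : (Fin m → AnyTerm σ) → AnyTerm σ} (h : HomRel E ⟨m, fun i => a (θ i)⟩ b F F) :
    act θ hθ a b (mk (a := ⟨m, fun i => a (θ i)⟩) F h) = mk (a := ⟨n, a⟩) _ (homRel_act hθ h) :=
  mk_eq_mk.2 (homRel_act hθ (rep_mk (a := ⟨m, fun i => a (θ i)⟩) h))

lemma exists_mk {a : Word σ.S} {b : σ.S} (f : THom E a b) : ∃ F hF, f = mk F hF :=
  ⟨_, _, (mk_rep f).symm⟩

lemma exists_mk_family {n : ℕ} {a : Fin n → Word σ.S} {b : Fin n → σ.S}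
    (f : ∀ i, THom E (a i) (b i)) :
    ∃ (F : ∀ i, (Fin (a i).len → AnyTerm σ) → AnyTerm σ)
      (hF : ∀ i, HomRel E (a i) (b i) (F i) (F i)), f = fun i => mk (F i) (hF i) :=
  ⟨_, _, funext fun i => (mk_rep (f i)).symm⟩

variable (E) in
/-- The multicategory of terms modulo derivable equations. -/
noncomputable def multicategory (hR : R.Modelable) :
    DeltaMulticategory.{uS, max uS uM uV} (σ.delta R) where
  Obj := σ.S
  Hom := THom E
  comp := comp hR
  id c := mk _ (homRel_id c)
  act := act
  assoc := by
    intro n m c d b a h g f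
    obtain ⟨H, hH, rfl⟩ := exists_mk h
    obtain ⟨G, hG, rfl⟩ := exists_mk_family g
    obtain ⟨F, hF, rfl⟩ : ∃ (F : ∀ i j, (Fin (a i j).len → AnyTerm σ) → AnyTerm σ)
        (hF : ∀ i j, HomRel E (a i j) (b i j) (F i j) (F i j)),
        f = fun i j => mk (F i j) (hF i j) :=
      ⟨_, _, funext fun i => funext fun j => (mk_rep (f i j)).symm⟩
    have h₁ := comp_mk hR hH hG
    have h₂ := comp_mk hR (b := fun k : Fin (∑ i, m i) =>
      b (finSigmaFinEquiv.symm k).1 (finSigmaFinEquiv.symm k).2) (homRel_comp hR hH hG)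
      (fun k => hF (finSigmaFinEquiv.symm k).1 (finSigmaFinEquiv.symm k).2)
    have h₃ i := comp_mk hR (hG i) (hF i)
    have h₄ := comp_mk hR hH (fun i => homRel_comp hR (hG i) (hF i))
    refine ((congrArg (castDom _) ((congrArg (fun g => comp hR (n := ∑ i, m i) g _) h₁).trans
      h₂)).trans (castDom_mk _ _)).trans (Eq.trans ?_
        ((congrArg (comp hR (mk H hH)) (funext h₃)).trans h₄).symm)
    -- Both sides apply the same operations; they differ only in how the doubly nested blocks of
    -- arguments are enumerated.
    refine mk_congr (funext fun x => congrArg H (funext fun i => congrArg (G i) (funext fun j => ?_)))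
    refine Eq.trans (congrArg (F _ _) (funext fun l => congrArg x
      (cast_finSigma_finSigma (fun i j => (a i j).len) _ _ l))) ?_
    exact congrArg (fun p : (i : Fin n) × Fin (m i) => F p.1 p.2 fun l =>
      x (finSigmaFinEquiv (n := fun i => ∑ j, (a i j).len)
        ⟨p.1, finSigmaFinEquiv (n := fun j => (a p.1 j).len) ⟨p.2, l⟩⟩))
      (Equiv.symm_apply_apply finSigmaFinEquiv ⟨i, j⟩)
  comp_id := by
    intro n a b f
    obtain ⟨F, hF, rfl⟩ := exists_mk f
    refine ((congrArg (castDom _) (comp_mk hR hF fun i => homRel_id (a i))).trans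
      (castDom_mk _ _)).trans ?_
    exact mk_congr (funext fun x => congrArg F (funext fun i =>
      congrArg x (cast_finSigma_single _ i 0)))
  id_comp := by
    intro a b f
    obtain ⟨F, hF, rfl⟩ := exists_mk f
    refine ((congrArg (castDom _) (comp_mk hR (homRel_id b) fun _ => hF)).trans
      (castDom_mk _ _)).trans ?_
    exact mk_congr (funext fun x => congrArg F (funext fun i =>
      congrArg x (cast_finSigma_one _ 0 i)))
  act_id := by
    intro n a b f
    obtain ⟨F, hF, rfl⟩ := exists_mk f
    exact act_mk _ _
  act_comp := by
    intro k m n θ τ hθ hτ a b f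
    obtain ⟨F, hF, rfl⟩ := exists_mk f
    exact (act_mk _ _).trans ((congrArg (act τ hτ a b) (act_mk hθ hF)).trans (act_mk hτ _)).symm
  comp_act := by
    intro n k b c a θ hθ g f
    obtain ⟨G, hG, rfl⟩ := exists_mk g
    obtain ⟨F, hF, rfl⟩ := exists_mk_family f
    refine ((congrArg (comp hR (mk G hG)) (funext fun i => act_mk (hθ i) (hF i))).trans
      (comp_mk hR hG fun i => homRel_act (hθ i) (hF i))).trans (Eq.trans ?_
        ((congrArg (act _ ((σ.delta R).coprod_mem hθ) (Word.concat a).get c)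
          ((congrArg (castDom _) (comp_mk hR hG hF)).trans (castDom_mk _ _))).trans
            (act_mk _ _)).symm)
    exact mk_congr (funext fun x => congrArg G (funext fun i => congrArg (F i) (funext fun j =>
      congrArg x (finCoprod_apply θ i j).symm)))
  act_comp' := by
    intro m n τ hτ b c a g f
    obtain ⟨G, hG, rfl⟩ := exists_mk g
    obtain ⟨F, hF, rfl⟩ := exists_mk_family f
    refine ((congrArg (fun g => comp hR g _) (act_mk hτ hG)).trans
      (comp_mk hR (homRel_act hτ hG) hF)).trans (Eq.trans ?_
        ((congrArg (act _ ((σ.delta R).similarity_mem _ hτ) (Word.concat a).get c)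
          ((congrArg (castDom _) (comp_mk hR hG fun i => hF (τ i))).trans
            (castDom_mk _ _))).trans (act_mk _ _)).symm)
    exact mk_congr (funext fun x => congrArg G (funext fun i => congrArg (F (τ i))
      (funext fun j => congrArg x (finSimilarity_apply τ (fun j => (a j).len) i j).symm)))

/-! ### The generic model and its satisfied equations -/

/-- The operation on terms given by a symbol. -/
noncomputable def symbolFun (f : σ.M) (x : Fin (σ.dom f).len → AnyTerm σ) : AnyTerm σ :=
  have : Nonempty (AnyTerm σ) := by
    obtain ⟨v, -, -⟩ := σ.exists_context fun _ : Fin 1 => σ.cod f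
    exact ⟨⟨_, .var (v 0)⟩⟩
  -- The value on ill-sorted tuples is arbitrary, which is harmless because `HomRel` tests only
  -- arguments of the prescribed sorts.
  Classical.epsilon fun p => ∃ t : ∀ i, Term σ ((σ.dom f).get i),
    x = (fun i => ⟨_, t i⟩) ∧ p = ⟨_, .app f t⟩

lemma symbolFun_apply (f : σ.M) (t : ∀ i, Term σ ((σ.dom f).get i)) :
    symbolFun f (fun i => ⟨_, t i⟩) = ⟨_, .app f t⟩ := by
  obtain ⟨t', h, h'⟩ := Classical.epsilon_spec_aux (h := ⟨⟨_, .app f t⟩⟩)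
    (p := fun p : AnyTerm σ => ∃ t' : ∀ i, Term σ ((σ.dom f).get i),
      (fun i => (⟨_, t i⟩ : AnyTerm σ)) = (fun i => ⟨_, t' i⟩) ∧ p = ⟨_, .app f t'⟩)
    ⟨_, t, rfl, rfl⟩
  obtain rfl : t = t' := funext fun i => eq_of_heq (Sigma.mk.inj (congrFun h i)).2
  exact h'

lemma homRel_symbolFun (f : σ.M) :
    HomRel E (σ.dom f) (σ.cod f) (symbolFun f) (symbolFun f) := by
  intro w w' x y hw hxy
  choose t t' hx hy h using hxy
  obtain rfl := funext hx
  obtain rfl := funext hy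
  exact ⟨_, _, symbolFun_apply f t, symbolFun_apply f t', Derives.app f hw h⟩

variable (E) in
/-- The model of a signature in the multicategory of terms. -/
noncomputable def model (hR : R.Modelable) : Model σ (multicategory E hR) where
  obj s := s
  op f := mk (symbolFun f) (homRel_symbolFun f)

/-- The operation is described only on tuples coming from one substitution, where repeated
occurrences receive the same term. No other tuples are needed for `model_satisfies_iff`. -/
lemma model_lin (hR : R.Modelable) {s : σ.S} (t : Term σ s) :
    ∃ (F : (Fin t.tau.len → AnyTerm σ) → AnyTerm σ) (hF : HomRel E (t.tau.map σ.vty) s F F),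
      (model E hR).lin t = mk (a := t.tau.map σ.vty) F hF ∧
      ∀ r : ∀ x : σ.V, Term σ (σ.vty x), F (fun i => ⟨_, r (t.tau.get i)⟩) = ⟨s, t.subst r⟩ := by
  induction t with
  | var x => exact ⟨fun y => y (0 : Fin 1), homRel_id (σ.vty x), rfl, fun r => rfl⟩
  | app f t ih =>
    choose F hF h hr using ih
    refine ⟨_, homRel_comp hR (a := fun i => (t i).tau.map σ.vty) (homRel_symbolFun f) hF, ?_,
      fun r => ?_⟩
    · refine (congrArg (comp hR (b := (σ.dom f).get) (a := fun i => (t i).tau.map σ.vty) _)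
        (funext h)).trans ?_
      exact comp_mk hR (b := (σ.dom f).get) (homRel_symbolFun f) hF
    · refine Eq.trans (congrArg (symbolFun f) (funext fun i => ?_)) (symbolFun_apply f _)
      refine Eq.trans (congrArg (F i) (funext fun j => ?_)) (hr i r)
      exact congrArg (fun x => (⟨_, r x⟩ : AnyTerm σ))
        (Word.concat_get (fun i => (t i).tau) ⟨i, j⟩)

lemma model_interp (hR : R.Modelable) {s : σ.S} (t : Term σ s) {v : Word σ.V}
    (hv : R.rel v t.tau) :
    ∃ (F : (Fin v.len → AnyTerm σ) → AnyTerm σ) (hF : HomRel E (v.map σ.vty) s F F),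
      (model E hR).interp hR t hv = mk (a := v.map σ.vty) F hF ∧
      ∀ r : ∀ x : σ.V, Term σ (σ.vty x), F (fun i => ⟨_, r (v.get i)⟩) = ⟨s, t.subst r⟩ := by
  obtain ⟨F, hF, h, hr⟩ := model_lin (E := E) hR t
  refine ⟨_, homRel_act (R.fn_mem hv) (homRel_cast (R.map_eq_fn hv σ.vty) hF), ?_, fun r => ?_⟩
  · rw [Model.interp_eq_canon_lin, h]
    refine (congrArg (act _ (R.fn_mem hv) _ _) (castDom_mk (R.map_eq_fn hv σ.vty) hF)).trans ?_
    exact act_mk _ _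
  · refine Eq.trans (congrArg F (funext fun i => ?_)) (hr r)
    exact congrArg (fun x => (⟨_, r x⟩ : AnyTerm σ)) (R.get_fn hv i)

/-- Being related under `HomRel` is closure of the equation under the substitution rule; conversely,
the identity substitution recovers the equation itself. -/
lemma model_satisfies_iff (hR : R.Modelable) (φ : REquation σ R) :
    (model E hR).Satisfies hR φ ↔ Proves E φ := by
  obtain ⟨F, hF, h, hr⟩ := model_interp (E := E) hR φ.lhs φ.rel_lhs
  obtain ⟨G, hG, h', hr'⟩ := model_interp (E := E) hR φ.rhs φ.rel_rhs
  have hφ : (model E hR).Satisfies hR φ ↔ HomRel E (φ.ctx.map σ.vty) φ.sort F G := by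
    change (model E hR).interp hR φ.lhs φ.rel_lhs = (model E hR).interp hR φ.rhs φ.rel_rhs ↔ _
    rw [h, h']
    exact mk_eq_mk
  have hctx := R.context φ.rel_lhs
  rw [hφ]
  constructor
  · intro H
    have hs (i : Fin φ.ctx.len) : R.rel (Word.single (φ.ctx.get i)) (Word.single (φ.ctx.get i)) :=
      R.refl fun _ _ _ => Subsingleton.elim (α := Fin 1) _ _
    -- The operations are evaluated at the variables of the context, where they return the two sides
    -- of the equation unchanged.
    obtain ⟨t, t', ht, ht', hd⟩ := H φ.ctx (fun i => Word.single (φ.ctx.get i))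
      (fun i => ⟨_, .var (φ.ctx.get i)⟩) (fun i => ⟨_, .var (φ.ctx.get i)⟩)
      ((Word.concat_single φ.ctx.get).symm ▸ R.refl hctx)
      (fun i => ⟨_, _, rfl, rfl, .refl _ (hs i)⟩)
    have e := (hr Term.var).symm.trans ht
    have e' := (hr' Term.var).symm.trans ht'
    rw [Term.subst_var] at e e'
    obtain rfl := eq_of_heq (Sigma.mk.inj e).2
    obtain rfl := eq_of_heq (Sigma.mk.inj e').2
    exact hd
  · intro H w w' x y hw hxy
    choose t t' hx hy hd using hxy
    obtain rfl := funext hx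
    obtain rfl := funext hy
    -- The letters of a context are distinct, so any well-sorted family of terms is the restriction
    -- of a substitution.
    obtain ⟨r, hrt⟩ := Term.exists_subst hctx t
    obtain ⟨r', hrt'⟩ := Term.exists_subst hctx t'
    obtain rfl := funext hrt
    obtain rfl := funext hrt'
    exact ⟨_, _, hr r, hr' r', .subst r r' w w' H hw (fun i => (hd i).rel.1)
      (fun i => (hd i).rel.2) hd⟩

end TermMulticategory

/-- Satisfaction is preserved by morphisms of multicategories. -/
lemma Model.Satisfies.map {σ : Signature.{uS, uM, uV}} {R : ContextStructure σ.V}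
    {C : DeltaMulticategory.{u, v} (σ.delta R)} {D : DeltaMulticategory.{w, w'} (σ.delta R)}
    {m : Model σ C} {hR : R.Modelable} {φ : REquation σ R} (h : m.Satisfies hR φ)
    (T : C.Functor D) : (m.map T).Satisfies hR φ :=
  (Model.map_interp m T hR _ _).symm.trans ((congrArg T.map h).trans (Model.map_interp m T hR _ _))

theorem mainTheorem4 (σ : Signature.{uS, uM, uV}) (R : ContextStructure σ.V) (hR : R.Modelable)
    (κ : R.ContextChoice) (E : Set (REquation σ R)) :
    (∃ C : SetModel.{max uS uM} (σ.ext (σ.delta R)), C.IsInitialModel (multicatTheory κ E)) ∧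
    ∀ (C : SetModel.{max uS uM} (σ.ext (σ.delta R)))
      (hC : C.IsInitialModel (multicatTheory κ E)),
      (C.toModel hC.categorization).SatisfiesTheory hR E ∧
      (∀ (D : DeltaMulticategory.{w, w'} (σ.delta R)) (n : Model σ D), n.SatisfiesTheory hR E →
        ∃! T : (C.toMulticategory hC.categorization).Functor D,
          (C.toModel hC.categorization).map T = n) ∧
      (∀ φ : REquation σ R, Proves E φ ↔ (C.toModel hC.categorization).Satisfies hR φ) ∧
      (∀ φ : REquation σ R, Proves E φ ↔
        ∀ (D : DeltaMulticategory.{uS, max uS uM} (σ.delta R)) (n : Model σ D),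
          n.SatisfiesTheory hR E → n.Satisfies hR φ) := by
  refine ⟨⟨_, SetModel.termModel_isInitialModel _⟩, fun C hC => ?_⟩
  have hm := hC.toModel_satisfiesTheory hR
  have hφ (φ : REquation σ R) :
      Proves E φ ↔ (C.toModel hC.categorization).Satisfies hR φ := by
    refine ⟨fun h => Model.interp_eq_of_derives _ hR hm h _ _, fun h => ?_⟩
    -- Completeness: the functor to the generic model carries the equation from `C` to a model where
    -- satisfaction means derivability.
    obtain ⟨T, hT, -⟩ := hC.existsUnique_functor hR (TermMulticategory.model E hR)
      fun e he => (TermMulticategory.model_satisfies_iff hR e).2 (.ax e he)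
    exact (TermMulticategory.model_satisfies_iff hR φ).1 (hT ▸ h.map T)
  -- For the last equivalence, validity in all models is tested on the initial one, which lies in
  -- the universes quantified over.
  refine ⟨hm, fun D n hn => hC.existsUnique_functor hR n hn, hφ, fun φ => ⟨fun h D n hn => ?_,
    fun h => (hφ φ).2 (h _ _ hm)⟩⟩
  exact Model.interp_eq_of_derives n hR hn h _ _
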